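/- For $n\ge 1$ let $\mathrm{Pow}(\mathbb{Z}_n)$ be the power graph of the cyclic group of order $n$: its vertices are the group elements, and two distinct elements are adjacent if and only if one of them is a positive power (in additive notation: a positive multiple) of the other. The problem Graph Motif on $\mathrm{Pow}(\mathbb{Z}_n)$ asks, given $\mathrm{Pow}(\mathbb{Z}_n)$ with a colouring of its vertices and given a finite multiset $M$ of colours, whether there is a set $V'$ of vertices that induces a connected (in particular non-empty) subgraph and whose multiset of colours is exactly $M$. (i) The neighbourhood diversity of $\mathrm{Pow}(\mathbb{Z}_n)$ is at most the number of divisors of $n$: the vertex set can be partitioned into at most that many sets such that any two vertices $u,v$ in the same set satisfy $N(u)\setminus\{v\}=N(v)\setminus\{u\}$. (ii) Graph Motif on $\mathrm{Pow}(\mathbb{Z}_n)$ can be solved in time $2^{o(n)}$. More specifically, there are a constant $c>0$ and a single deterministic algorithm for all $n$ that runs in time $2^{o(n)}$ and in time at most $2^{\,n^{c/\log\log n}}$ for all $n\ge 3$. This holds both when the input graph is given only by the adjacency matrix of a graph on $\{0,\dots,n-1\}$ isomorphic to $\mathrm{Pow}(\mathbb{Z}_n)$, and when it is given by the Cayley table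 of a cyclic group of order $n$ whose elements are numbered $0,\dots,n-1$ in any way. Time is the number of steps of a random access machine whose arithmetic operations are addition and truncated subtraction of natural numbers, each instruction taking one step; colours are natural numbers stored in one memory cell each. -/

import Mathlib

namespace CyclicMotif

/-! ### Graphs: power graphs, Graph Motif, neighbourhood diversity -/

/-- The power graph of a group: distinct `x`, `y` are adjacent iff one of them is a power of the
other with positive exponent (`SimpleGraph.fromRel` symmetrizes and removes the loops). -/
def powerGraph (G : Type*) [Group G] : SimpleGraph G :=
  SimpleGraph.fromRel fun x y => ∃ m : ℕ, 0 < m ∧ y = x ^ m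

/-- The cyclic group `ℤ_n`, written multiplicatively. -/
abbrev Zn (n : ℕ) : Type := Multiplicative (ZMod n)

/-- The motif `M` (a multiset of colours) occurs in the graph `Γ` coloured by `col`: some set of
vertices induces a connected subgraph and its multiset of colours is exactly `M`. -/
def MotifOccurs {V C : Type*} (Γ : SimpleGraph V) (col : V → C) (M : Multiset C) : Prop :=
  ∃ S : Finset V, (Γ.induce (S : Set V)).Connected ∧ S.val.map col = M

/-- Two vertices have the same type: `N(u) \ {v} = N(v) \ {u}`. -/
def SameType {V : Type*} (Γ : SimpleGraph V) (u v : V) : Prop :=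
  Γ.neighborSet u \ {v} = Γ.neighborSet v \ {u}

/-- `Γ` has neighbourhood diversity at most `w`: the vertices can be partitioned into at most `w`
sets (the fibres of `part`) such that all vertices in each set have the same type. -/
def NeighbourhoodDiversityLE {V : Type*} (Γ : SimpleGraph V) (w : ℕ) : Prop :=
  ∃ part : V → Fin w, ∀ u v, part u = part v → SameType Γ u v

/-! ### A unit-cost random access machine

Registers and memory cells hold natural numbers; a program is a finite text, so it uses finitely
many registers and finitely many memory arrays. The arithmetic operations are addition and
truncated subtraction only; each elementary instruction and each test takes one step. -/

/-- Machine states: `reg i` is the content of register `i`, and `mem a i` is the content of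
cell `i` of the array `a`. -/
structure State where
  reg : ℕ → ℕ
  mem : ℕ → ℕ → ℕ

/-- Set register `x` to `v`. -/
def State.setReg (s : State) (x v : ℕ) : State :=
  { s with reg := Function.update s.reg x v }

/-- Set cell `i` of array `a` to `v`. -/
def State.setMem (s : State) (a i v : ℕ) : State :=
  { s with mem := Function.update s.mem a (Function.update (s.mem a) i v) }

/-- Programs. Here `x`, `y`, `z` are names of registers and `a` is the name of an array. -/
inductive Prog : Type
  /-- `x := k` -/
  | const (x k : ℕ)
  /-- `x := y + z` -/
  | add (x y z : ℕ)
  /-- `x := y - z` (truncated at `0`) -/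
  | sub (x y z : ℕ)
  /-- `x := a[y]` (indirect load) -/
  | load (x a y : ℕ)
  /-- `a[y] := x` (indirect store) -/
  | store (a y x : ℕ)
  /-- `p ; q` -/
  | seq (p q : Prog)
  /-- `if x < y then p else q` -/
  | ite (x y : ℕ) (p q : Prog)
  /-- `while x < y do p` -/
  | loop (x y : ℕ) (p : Prog)

/-- `Run p s s' t`: started in state `s`, the program `p` halts in state `s'` after exactly
`t` steps. -/
inductive Run : Prog → State → State → ℕ → Prop
  | const (x k : ℕ) (s : State) : Run (.const x k) s (s.setReg x k) 1
  | add (x y z : ℕ) (s : State) : Run (.add x y z) s (s.setReg x (s.reg y + s.reg z)) 1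
  | sub (x y z : ℕ) (s : State) : Run (.sub x y z) s (s.setReg x (s.reg y - s.reg z)) 1
  | load (x a y : ℕ) (s : State) : Run (.load x a y) s (s.setReg x (s.mem a (s.reg y))) 1
  | store (a y x : ℕ) (s : State) : Run (.store a y x) s (s.setMem a (s.reg y) (s.reg x)) 1
  | seq {p q : Prog} {s s' s'' : State} {t t' : ℕ} (hp : Run p s s' t) (hq : Run q s' s'' t') :
      Run (.seq p q) s s'' (t + t')
  | ite_true {x y : ℕ} {p q : Prog} {s s' : State} {t : ℕ} (h : s.reg x < s.reg y)
      (hp : Run p s s' t) : Run (.ite x y p q) s s' (1 + t)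
  | ite_false {x y : ℕ} {p q : Prog} {s s' : State} {t : ℕ} (h : ¬ s.reg x < s.reg y)
      (hq : Run q s s' t) : Run (.ite x y p q) s s' (1 + t)
  | loop_true {x y : ℕ} {p : Prog} {s s' s'' : State} {t t' : ℕ} (h : s.reg x < s.reg y)
      (hp : Run p s s' t) (hl : Run (.loop x y p) s' s'' t') :
      Run (.loop x y p) s s'' (1 + t + t')
  | loop_false {x y : ℕ} {p : Prog} {s : State} (h : ¬ s.reg x < s.reg y) :
      Run (.loop x y p) s s 1

/-- The machine is deterministic: the final state and the number of steps are determined by the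
program and the initial state. -/
theorem Run.deterministic {p : Prog} {s s₁ s₂ : State} {t₁ t₂ : ℕ}
    (h₁ : Run p s s₁ t₁) (h₂ : Run p s s₂ t₂) : s₁ = s₂ ∧ t₁ = t₂ := by
  induction h₁ generalizing s₂ t₂ with
  | const | add | sub | load | store => cases h₂; exact ⟨rfl, rfl⟩
  | seq _ _ ih ih' =>
    cases h₂ with
    | seq k k' =>
      obtain ⟨rfl, rfl⟩ := ih k
      obtain ⟨rfl, rfl⟩ := ih' k'
      exact ⟨rfl, rfl⟩
  | ite_true h _ ih =>
    cases h₂ with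
    | ite_true _ k => obtain ⟨rfl, rfl⟩ := ih k; exact ⟨rfl, rfl⟩
    | ite_false h' => exact absurd h h'
  | ite_false h _ ih =>
    cases h₂ with
    | ite_true h' => exact absurd h' h
    | ite_false _ k => obtain ⟨rfl, rfl⟩ := ih k; exact ⟨rfl, rfl⟩
  | loop_true h _ _ ih ih' =>
    cases h₂ with
    | loop_true _ k k' =>
      obtain ⟨rfl, rfl⟩ := ih k
      obtain ⟨rfl, rfl⟩ := ih' k'
      exact ⟨rfl, rfl⟩
    | loop_false h' => exact absurd h h'
  | loop_false h =>
    cases h₂ with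
    | loop_true h' => exact absurd h' h
    | loop_false => exact ⟨rfl, rfl⟩

/-- Started in state `s`, the program `p` halts after at most `T` steps with the correct answer to
the question `Q` in register `0` (`1` for yes, `0` for no). -/
def DecidesWithin (p : Prog) (s : State) (Q : Prop) (T : ℕ) : Prop :=
  ∃ (s' : State) (t : ℕ), Run p s s' t ∧ t ≤ T ∧ ((Q ∧ s'.reg 0 = 1) ∨ (¬ Q ∧ s'.reg 0 = 0))

/-! ### Inputs -/

/-- The initial state for an `n × n` table of numbers, a colouring of `n` vertices and a motif:
register `0` holds `n`, register `1` holds the size of the motif; array `0` holds the table row by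
row, array `1` the colours of the vertices and array `2` the motif. All else is `0`. -/
def input (n : ℕ) (table : Fin n → Fin n → ℕ) (col : Fin n → ℕ) (motif : List ℕ) : State where
  reg := fun r => if r = 0 then n else if r = 1 then motif.length else 0
  mem := fun a i =>
    if a = 0 then
      if h : i < n * n then table (Fin.divNat ⟨i, h⟩) (Fin.modNat ⟨i, h⟩) else 0
    else if a = 1 then
      if h : i < n then col ⟨i, h⟩ else 0
    else if a = 2 then
      motif.getD i 0
    else 0

open Classical in
/-- Adjacency matrix with entries `0` and `1`. -/
noncomputable def adjTable {n : ℕ} (Γ : SimpleGraph (Fin n)) : Fin n → Fin n → ℕ :=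
  fun i j => if Γ.Adj i j then 1 else 0

/-- Cayley table of a group of order `n` whose elements are numbered by `e`. -/
def cayleyTable {n : ℕ} {G : Type*} [Group G] (e : Fin n ≃ G) : Fin n → Fin n → ℕ :=
  fun i j => (e.symm (e i * e j) : Fin n)

/-- `p` solves Graph Motif on power graphs of cyclic groups in time `T`, where `n` is the order of
the group, and the input is the adjacency matrix of a graph isomorphic to the power graph of `ℤ_n`
(without any information on the group), the colouring, and the motif. -/
def SolvesFromGraph (p : Prog) (T : ℕ → ℕ) : Prop :=
  ∀ n : ℕ, 0 < n → ∀ Γ : SimpleGraph (Fin n), Nonempty (Γ ≃g powerGraph (Zn n)) →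
    ∀ (col : Fin n → ℕ) (motif : List ℕ),
      DecidesWithin p (input n (adjTable Γ) col motif) (MotifOccurs Γ col (motif : Multiset ℕ))
        (T n)

/-- The same with the Cayley table of the cyclic group, with its elements numbered in any way, in
place of the adjacency matrix. Vertices are identified with their numbers. -/
def SolvesFromGroup (p : Prog) (T : ℕ → ℕ) : Prop :=
  ∀ n : ℕ, 0 < n → ∀ e : Fin n ≃ Zn n,
    ∀ (col : Fin n → ℕ) (motif : List ℕ),
      DecidesWithin p (input n (cayleyTable e) col motif)
        (MotifOccurs ((powerGraph (Zn n)).comap e) col (motif : Multiset ℕ)) (T n)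

/-- `T n = 2 ^ {o(n)}`. -/
def IsTwoPowLittleO (T : ℕ → ℕ) : Prop :=
  ∃ f : ℕ → ℝ, Asymptotics.IsLittleO Filter.atTop f (fun n : ℕ => (n : ℝ)) ∧
    ∀ n : ℕ, 0 < n → (T n : ℝ) ≤ (2 : ℝ) ^ f n

/-- `T n ≤ 2 ^ (n ^ (c / log log n))` for some constant `c > 0` and all `n ≥ 3` (so that
`log log n > 0`). -/
def IsTwoPowPowDivLogLog (T : ℕ → ℕ) : Prop :=
  ∃ c : ℝ, 0 < c ∧ ∀ n : ℕ, 3 ≤ n →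
    (T n : ℝ) ≤ (2 : ℝ) ^ ((n : ℝ) ^ (c / Real.log (Real.log (n : ℝ))))

end CyclicMotif

namespace CyclicMotif

/-! ### A program logic with time bounds -/

/-! In a finite cyclic group, elements of equal order generate the same subgroup
(`zpowers_le_of_orderOf_eq`), and adjacency in the power graph depends only on the generated
subgroups. The classes of equal order are therefore cliques of vertices of one type, one class for
each divisor of `n` (`hasCliqueTypes_powerGraph`). This is already the bound on neighbourhood
diversity.

Let `k` be the number of divisors. A connected set `S` contains a sequence of `k` vertices,
repetitions allowed, in which each vertex after the first touches an earlier one and which meets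
every class that `S` meets; as classes are cliques, it dominates `S` (`exists_isChain_dominating`).
Conversely, every set between such a sequence and its closed neighbourhood is connected
(`connected_of_isChain`), and one with colour multiset `M` exists exactly when `M` lies between the
colours of the two extremes (`exists_finset_between`). So it suffices to test all `n ^ k` sequences,
coded as numbers in base `n`, with a polynomial test for each (`exists_accepts_iff`, `solve_ends`).
The algorithm needs only the adjacency matrix and `k`, never the classes themselves; a Cayley table
is first turned into an adjacency matrix (`powerAdjacency_ends`).

The time is at most `(n + 32) ^ (26 * k)`. The divisor bound `log k ≤ 10 * log n / log (log n)`
(`log_card_divisors_le`) makes this `2 ^ (n ^ (c / log log n))`, which is `2 ^ o(n)` because the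
inner exponent tends to `0`. -/

@[simp] theorem State.reg_setReg (s : State) (x v r : ℕ) :
    (s.setReg x v).reg r = if r = x then v else s.reg r := by
  simp [State.setReg, Function.update_apply]

@[simp] theorem State.mem_setReg (s : State) (x v : ℕ) : (s.setReg x v).mem = s.mem := rfl

@[simp] theorem State.reg_setMem (s : State) (a i v : ℕ) : (s.setMem a i v).reg = s.reg := rfl

@[simp] theorem State.mem_setMem (s : State) (a i v b j : ℕ) :
    (s.setMem a i v).mem b j = if b = a then (if j = i then v else s.mem b j) else s.mem b j := by
  unfold State.setMem
  by_cases h : b = a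
  · subst h; simp [Function.update_apply]
  · simp [h]

theorem State.mem_setMem_of_ne (s : State) {a b : ℕ} (i v : ℕ) (h : b ≠ a) :
    (s.setMem a i v).mem b = s.mem b := by
  simp [State.setMem, h]

namespace Prog

/-- The program contains an instruction that writes register `r`. -/
def writes : Prog → ℕ → Bool
  | const x _, r => r == x
  | add x _ _, r => r == x
  | sub x _ _, r => r == x
  | load x _ _, r => r == x
  | store _ _ _, _ => false
  | seq p q, r => p.writes r || q.writes r
  | ite _ _ p q, r => p.writes r || q.writes r
  | loop _ _ p, r => p.writes r

/-- The program contains an instruction that writes into the array `a`. -/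
def stores : Prog → ℕ → Bool
  | const _ _, _ => false
  | add _ _ _, _ => false
  | sub _ _ _, _ => false
  | load _ _ _, _ => false
  | store b _ _, a => a == b
  | seq p q, a => p.stores a || q.stores a
  | ite _ _ p q, a => p.stores a || q.stores a
  | loop _ _ p, a => p.stores a

/-- `s'` agrees with `s` on all registers and arrays that `p` does not write. -/
def Frame (p : Prog) (s s' : State) : Prop :=
  (∀ r, p.writes r = false → s'.reg r = s.reg r) ∧ ∀ a, p.stores a = false → s'.mem a = s.mem a

theorem Frame.refl (p : Prog) (s : State) : p.Frame s s := ⟨fun _ _ => rfl, fun _ _ => rfl⟩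

theorem Frame.trans {p : Prog} {s₁ s₂ s₃ : State} (h : p.Frame s₁ s₂) (h' : p.Frame s₂ s₃) :
    p.Frame s₁ s₃ :=
  ⟨fun r hr => (h'.1 r hr).trans (h.1 r hr), fun a ha => (h'.2 a ha).trans (h.2 a ha)⟩

end Prog

/-- This carries values past a subprogram. Since `writes` and `stores` are computable, the side
conditions for concrete registers are closed by `rfl`, as in the terms `f₁.1 0 rfl` below. -/
theorem Run.frame {p : Prog} {s s' : State} {t : ℕ} (h : Run p s s' t) : p.Frame s s' := by
  induction h with
  | const | add | sub | load =>
    refine ⟨fun r hr => ?_, fun _ _ => rfl⟩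
    simp only [Prog.writes, beq_eq_false_iff_ne] at hr
    simp [hr]
  | store =>
    refine ⟨fun r hr => rfl, fun a ha => ?_⟩
    simp only [Prog.stores, beq_eq_false_iff_ne] at ha
    exact State.mem_setMem_of_ne _ _ _ ha
  | seq _ _ ih ih' =>
    constructor
    · intro r hr
      simp only [Prog.writes, Bool.or_eq_false_iff] at hr
      rw [ih'.1 r hr.2, ih.1 r hr.1]
    · intro a ha
      simp only [Prog.stores, Bool.or_eq_false_iff] at ha
      rw [ih'.2 a ha.2, ih.2 a ha.1]
  | ite_true _ _ ih | ite_false _ _ ih =>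
    constructor
    · intro r hr
      simp only [Prog.writes, Bool.or_eq_false_iff] at hr
      first | exact ih.1 r hr.1 | exact ih.1 r hr.2
    · intro a ha
      simp only [Prog.stores, Bool.or_eq_false_iff] at ha
      first | exact ih.2 a ha.1 | exact ih.2 a ha.2
  | loop_true _ _ _ ih ih' =>
    exact ⟨fun r hr => (ih'.1 r hr).trans (ih.1 r hr), fun a ha => (ih'.2 a ha).trans (ih.2 a ha)⟩
  | loop_false => exact Prog.Frame.refl _ _

namespace Prog

/-- Started in `s`, the program `p` halts within `t` steps in a state satisfying `Q`. -/
def Ends (p : Prog) (s : State) (t : ℕ) (Q : State → Prop) : Prop :=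
  ∃ s' t', Run p s s' t' ∧ t' ≤ t ∧ Q s'

theorem Ends.mono {p : Prog} {s : State} {t t' : ℕ} {Q : State → Prop} (h : p.Ends s t Q)
    (ht : t ≤ t') : p.Ends s t' Q := by
  obtain ⟨s', u, hr, hu, hQ⟩ := h
  exact ⟨s', u, hr, hu.trans ht, hQ⟩

theorem Ends.imp {p : Prog} {s : State} {t : ℕ} {Q Q' : State → Prop} (h : p.Ends s t Q)
    (hQ : ∀ s', p.Frame s s' → Q s' → Q' s') : p.Ends s t Q' := by
  obtain ⟨s', u, hr, hu, h⟩ := h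
  exact ⟨s', u, hr, hu, hQ s' hr.frame h⟩

theorem Ends.seq {p q : Prog} {s : State} {t t' : ℕ} {Q R : State → Prop} (hp : p.Ends s t Q)
    (hq : ∀ s', p.Frame s s' → Q s' → q.Ends s' t' R) : (p.seq q).Ends s (t + t') R := by
  obtain ⟨s', u, hr, hu, h⟩ := hp
  obtain ⟨s'', u', hr', hu', h'⟩ := hq s' hr.frame h
  exact ⟨s'', u + u', hr.seq hr', add_le_add hu hu', h'⟩

theorem Ends.ite {p q : Prog} {x y : ℕ} {s : State} {t : ℕ} {Q : State → Prop}
    (hp : s.reg x < s.reg y → p.Ends s t Q) (hq : ¬ s.reg x < s.reg y → q.Ends s t Q) :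
    (Prog.ite x y p q).Ends s (1 + t) Q := by
  by_cases h : s.reg x < s.reg y
  · obtain ⟨s', u, hr, hu, h'⟩ := hp h
    exact ⟨s', 1 + u, .ite_true h hr, by omega, h'⟩
  · obtain ⟨s', u, hr, hu, h'⟩ := hq h
    exact ⟨s', 1 + u, .ite_false h hr, by omega, h'⟩

/-! ### Programs without loops -/

/-- The program has no loops. -/
def straight : Prog → Bool
  | seq p q => p.straight && q.straight
  | ite _ _ p q => p.straight && q.straight
  | loop _ _ _ => false
  | _ => true

/-- The effect of a program without loops. -/
def eval : Prog → State → State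
  | const x k, s => s.setReg x k
  | add x y z, s => s.setReg x (s.reg y + s.reg z)
  | sub x y z, s => s.setReg x (s.reg y - s.reg z)
  | load x a y, s => s.setReg x (s.mem a (s.reg y))
  | store a y x, s => s.setMem a (s.reg y) (s.reg x)
  | seq p q, s => q.eval (p.eval s)
  | ite x y p q, s => if s.reg x < s.reg y then p.eval s else q.eval s
  | loop _ _ _, s => s

/-- The number of nodes, a bound for the time of a program without loops. -/
def size : Prog → ℕ
  | seq p q => p.size + q.size
  | ite _ _ p q => 1 + p.size + q.size
  | _ => 1

theorem ends_of_straight {p : Prog} (hp : p.straight = true) (s : State) :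
    p.Ends s p.size (fun s' => s' = p.eval s) := by
  induction p generalizing s with
  | const x k => exact ⟨_, 1, .const .., le_rfl, rfl⟩
  | add x y z => exact ⟨_, 1, .add .., le_rfl, rfl⟩
  | sub x y z => exact ⟨_, 1, .sub .., le_rfl, rfl⟩
  | load x y z => exact ⟨_, 1, .load .., le_rfl, rfl⟩
  | store x y z => exact ⟨_, 1, .store .., le_rfl, rfl⟩
  | seq p q ihp ihq =>
    simp only [straight, Bool.and_eq_true] at hp
    refine (ihp hp.1 s).seq fun s' _ h => ?_
    subst h
    exact ihq hp.2 _
  | ite x y p q ihp ihq =>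
    simp only [straight, Bool.and_eq_true] at hp
    have h : (Prog.ite x y p q).size = 1 + (p.size + q.size) := by simp [size]; ring
    rw [h]
    refine Ends.ite (fun h => ?_) fun h => ?_
    · exact ((ihp hp.1 s).mono (by omega)).imp fun s' _ h' => by simp [h', eval, h]
    · exact ((ihq hp.2 s).mono (by omega)).imp fun s' _ h' => by simp [h', eval, h]
  | loop => simp [straight] at hp

theorem Ends.of_eval {p : Prog} {s : State} {t : ℕ} {Q : State → Prop}
    (hp : p.straight = true) (ht : p.size ≤ t) (hQ : Q (p.eval s)) : p.Ends s t Q :=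
  ((ends_of_straight hp s).mono ht).imp fun _ _ h => h ▸ hQ

/-! ### Counting loops and other abbreviations

Registers `97`, `98`, `99` are scratch. -/

/-- `for i < b do p`. -/
def loopUp (i b : ℕ) (p : Prog) : Prog :=
  seq (const i 0) (loop i b (seq p (seq (const 98 1) (add i i 98))))

/-- Do nothing. -/
def skip : Prog := const 99 0

/-- `x := y` -/
def copy (x y : ℕ) : Prog := seq (const 97 0) (add x y 97)

/-- `x := x + 1` -/
def incr (x : ℕ) : Prog := seq (const 97 1) (add x x 97)

/-- `if x = y then p` -/
def ifEq (x y : ℕ) (p : Prog) : Prog := ite x y skip (ite y x skip p)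

/-- `if 0 < x then p` -/
def ifPos (x : ℕ) (p : Prog) : Prog := seq (const 97 0) (ite 97 x p skip)

/-- The counter and the bound of a counting loop are not written by its body. -/
def loopOk (i b : ℕ) (p : Prog) : Bool :=
  !p.writes i && !p.writes b && !(i == b) && !(i == 98) && !(b == 98)

/-- A round costs the body, one test and two steps for the increment; the final `2` pays for the
initialization and the failing test. The invariant is required after the updates of `98` and `i`,
since these follow the body. -/
theorem Ends.loopUp {i b n t : ℕ} {p : Prog} {s : State} (Inv : ℕ → State → Prop)
    (hok : loopOk i b p = true) (hb : s.reg b = n) (h0 : Inv 0 (s.setReg i 0))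
    (step : ∀ j < n, ∀ s', (Prog.loopUp i b p).Frame s s' → s'.reg i = j → Inv j s' →
      p.Ends s' t fun s'' => Inv (j + 1) ((s''.setReg 98 1).setReg i (j + 1))) :
    (Prog.loopUp i b p).Ends s (n * (t + 3) + 2) (Inv n) := by
  simp only [loopOk, Bool.and_eq_true, Bool.not_eq_true', beq_eq_false_iff_ne] at hok
  obtain ⟨⟨⟨⟨hi, hbp⟩, hib⟩, hi98⟩, hb98⟩ := hok
  have hwb : (Prog.loopUp i b p).writes b = false := by
    simp [Prog.loopUp, writes, hbp, hb98, Ne.symm hib]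
  have key : ∀ d j s', j + d = n → (Prog.loopUp i b p).Frame s s' → s'.reg i = j → Inv j s' →
      (loop i b (Prog.seq p (Prog.seq (const 98 1) (add i i 98)))).Ends s' (d * (t + 3) + 1)
        (Inv n) := by
    intro d
    induction d with
    | zero =>
      intro j s' hj hf hij hI
      refine ⟨s', 1, .loop_false ?_, by simp, ?_⟩
      · rw [hf.1 b hwb, hij, hb]; omega
      · rwa [← hj]
    | succ d ih =>
      intro j s' hj hf hij hI
      obtain ⟨s₁, t₁, hr, ht, hI'⟩ := step j (by omega) s' hf hij hI
      have e : s₁.reg i = j := by rw [hr.frame.1 i hi, hij]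
      have hbody : Run (Prog.seq p (Prog.seq (const 98 1) (add i i 98))) s'
          ((s₁.setReg 98 1).setReg i (j + 1)) (t₁ + (1 + 1)) := by
        refine hr.seq (Run.seq (.const ..) ?_)
        have := Run.add i i 98 (s₁.setReg 98 1)
        simpa [hi98, e] using this
      have hf' : (Prog.loopUp i b p).Frame s' ((s₁.setReg 98 1).setReg i (j + 1)) := by
        have := hbody.frame
        refine ⟨fun r hr => this.1 r ?_, fun a ha => this.2 a ?_⟩
        · simp only [Prog.loopUp, writes, Bool.or_eq_false_iff] at hr ⊢
          exact hr.2
        · simp only [Prog.loopUp, stores, Bool.or_eq_false_iff] at ha ⊢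
          exact ha.2
      obtain ⟨s₂, t₂, hr₂, ht₂, hQ⟩ := ih (j + 1) _ (by omega) (hf.trans hf') (by simp) hI'
      refine ⟨s₂, 1 + (t₁ + (1 + 1)) + t₂, .loop_true ?_ hbody hr₂, ?_, hQ⟩
      · rw [hf.1 b hwb, hij, hb]; omega
      · rw [add_mul]; omega
  obtain ⟨s', t', hr, ht, hQ⟩ := key n 0 (s.setReg i 0) (by omega)
    ⟨fun r hr => by
      simp only [Prog.loopUp, writes, Bool.or_eq_false_iff, beq_eq_false_iff_ne] at hr
      simp [hr.1], fun a ha => rfl⟩ (by simp) h0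
  exact ⟨s', 1 + t', (Run.const ..).seq hr, by omega, hQ⟩

/-- Time bounds for loops, in powers of a bound `W` for all loop lengths. -/
theorem loop_time {n W : ℕ} (a : ℕ) (hn : n ≤ W) (hW : 32 ≤ W) :
    n * (W ^ a + 3) + 2 ≤ W ^ (a + 2) := by
  have h1 : 1 ≤ W ^ a := Nat.one_le_pow _ _ (by omega)
  calc n * (W ^ a + 3) + 2 ≤ W * (W ^ a + 3 * W ^ a) + 2 * W ^ a * 1 := by
        gcongr <;> omega
    _ ≤ W * (W ^ a + 3 * W ^ a) + 2 * W ^ a * W := by gcongr; omega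
    _ = W ^ a * W * 6 := by ring
    _ ≤ W ^ a * W * W := by gcongr; omega
    _ = W ^ (a + 2) := by ring

theorem Ends.loopUp_pow {i b n W : ℕ} (a : ℕ) {p : Prog} {s : State} (Inv : ℕ → State → Prop)
    (hok : loopOk i b p = true) (hb : s.reg b = n) (hn : n ≤ W) (hW : 32 ≤ W)
    (h0 : Inv 0 (s.setReg i 0))
    (step : ∀ j < n, ∀ s', (Prog.loopUp i b p).Frame s s' → s'.reg i = j → Inv j s' →
      p.Ends s' (W ^ a) fun s'' => Inv (j + 1) ((s''.setReg 98 1).setReg i (j + 1))) :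
    (Prog.loopUp i b p).Ends s (W ^ (a + 2)) (Inv n) :=
  (Ends.loopUp Inv hok hb h0 step).mono (loop_time a hn hW)

end Prog

/-! ### Colour counts and the condition on a single colour -/

/-- The number of indices `v < n` with colour `x`, weighted by `g`. -/
def colorCount (n : ℕ) (c g : ℕ → ℕ) (x : ℕ) : ℕ :=
  ∑ v ∈ Finset.range n, if c v = x then g v else 0

/-- The motif contains colour `x` at least as often as the selected vertices and at most as often
as the dominated vertices do. -/
def ColorFits (n m : ℕ) (c μ sel dom : ℕ → ℕ) (x : ℕ) : Prop :=
  colorCount n c sel x ≤ colorCount m μ (fun _ => 1) x ∧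
    colorCount m μ (fun _ => 1) x ≤ colorCount n c dom x

namespace Prog

theorem Ends.pow_mono {p : Prog} {s : State} {W a b : ℕ} {Q : State → Prop}
    (h : p.Ends s (W ^ a) Q) (hW : 32 ≤ W) (hab : a ≤ b) : p.Ends s (W ^ b) Q :=
  h.mono (Nat.pow_le_pow_right (by omega) hab)

/-- All times are measured in powers of one bound `W`: composition raises the exponent by one, a
counting loop by two. Constants disappear because `W ≥ 32`. -/
theorem Ends.seq_pow {p q : Prog} {s : State} {W a : ℕ} {Q R : State → Prop} (hW : 32 ≤ W)
    (hp : p.Ends s (W ^ a) Q) (hq : ∀ s', p.Frame s s' → Q s' → q.Ends s' (W ^ a) R) :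
    (p.seq q).Ends s (W ^ (a + 1)) R :=
  (hp.seq hq).mono (by
    rw [pow_succ]
    have : W ^ a * 2 ≤ W ^ a * W := by gcongr; omega
    omega)

/-- The threshold `32` is chosen so that every loop-free block fits into a single factor `W`. -/
theorem Ends.of_eval_pow {p : Prog} {s : State} {W : ℕ} (a : ℕ) {Q : State → Prop} (hW : 32 ≤ W)
    (hp : p.straight = true) (ht : p.size ≤ 32) (hQ : Q (p.eval s)) : p.Ends s (W ^ (a + 1)) Q :=
  (Ends.of_eval (t := W ^ 1) hp (by rw [pow_one]; omega) hQ).pow_mono hW (by omega)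

theorem ends_eval_pow {p : Prog} {s : State} {W : ℕ} (a : ℕ) (hW : 32 ≤ W)
    (hp : p.straight = true) (ht : p.size ≤ 32) :
    p.Ends s (W ^ (a + 1)) fun s' => s' = p.eval s :=
  Ends.of_eval_pow a hW hp ht rfl

/-! ### Counting colours -/

/-- `r₂₀ := r₂₂ * r₀ + r₂₃` -/
def mulAdd : Prog :=
  seq (seq (const 20 0) (loopUp 21 22 (add 20 20 0))) (add 20 20 23)

/-- Without a multiplication instruction, the address of a matrix entry has to be computed by
repeated addition. -/
theorem mulAdd_ends {s : State} {W : ℕ} (hW : 32 ≤ W) (h : s.reg 22 ≤ W) :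
    mulAdd.Ends s (W ^ 5) fun s' => s'.reg 20 = s.reg 22 * s.reg 0 + s.reg 23 := by
  refine Ends.seq_pow hW (Q := fun s' => s'.reg 20 = s.reg 22 * s.reg 0)
    (Ends.seq_pow hW (Q := fun s' => s'.reg 20 = 0)
      (Ends.of_eval_pow 2 hW rfl (by decide) (by simp [eval]))
      fun s₁ hf₁ h₁ => Ends.loopUp_pow 1 (fun j s' => s'.reg 20 = j * s.reg 0) rfl
        (hf₁.1 22 rfl) h hW (by simp [h₁]) fun j _ s' hf _ hI => ?_)
    fun s₂ hf₂ h₂ => Ends.of_eval_pow 3 hW rfl (by decide) ?_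
  · refine Ends.of_eval_pow 0 hW rfl (by decide) ?_
    simp [eval, hI, hf.1 0 rfl, hf₁.1 0 rfl, add_mul]
  · simp [eval, h₂, hf₂.1 23 rfl]

/-- Count, in register `34`, the vertices of colour `r₃₀` that are marked in the array `mk`. -/
def countMarked (mk : ℕ) : Prog :=
  seq (const 34 0) (loopUp 33 0
    (seq (load 31 1 33) (seq (load 32 mk 33) (ifEq 31 30 (add 34 34 32)))))

theorem countMarked_ends (mk : ℕ) {s : State} {W : ℕ} (hW : 32 ≤ W) (h : s.reg 0 ≤ W) :
    (countMarked mk).Ends s (W ^ 4) fun s' =>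
      s'.reg 34 = colorCount (s.reg 0) (s.mem 1) (s.mem mk) (s.reg 30) := by
  refine Ends.seq_pow hW (Q := fun s' => s'.reg 34 = 0)
      (Ends.of_eval_pow 2 hW rfl (by decide) (by simp [eval]))
      fun s₁ hf₁ h₁ => Ends.loopUp_pow 1
        (fun j s' => s'.reg 34 = colorCount j (s.mem 1) (s.mem mk) (s.reg 30)) rfl
        (hf₁.1 0 rfl) h hW (by simp [h₁, colorCount]) fun j _ s' hf hj hI => ?_
  refine Ends.of_eval_pow 0 hW rfl (by simp [ifEq, size, skip]) ?_
  have e30 : s'.reg 30 = s.reg 30 := (hf.1 30 rfl).trans (hf₁.1 30 rfl)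
  have e1 : s'.mem 1 = s.mem 1 := (hf.2 1 rfl).trans (hf₁.2 1 rfl)
  have e2 : s'.mem mk = s.mem mk := (hf.2 mk rfl).trans (hf₁.2 mk rfl)
  simp only [colorCount, Finset.sum_range_succ] at hI ⊢
  simp only [eval, ifEq, skip, State.reg_setReg, State.mem_setReg, e30, e1, e2, hj, hI,
    apply_ite State.reg, ite_apply]
  simp only [Nat.reduceEqDiff, if_true, if_false]
  split_ifs <;> omega

/-- Count, in register `35`, the elements of the motif that have colour `r₃₀`. -/
def countMotif : Prog :=
  seq (const 35 0) (loopUp 33 1 (seq (load 31 2 33) (ifEq 31 30 (incr 35))))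

theorem countMotif_ends {s : State} {W : ℕ} (hW : 32 ≤ W) (h : s.reg 1 ≤ W) :
    countMotif.Ends s (W ^ 4) fun s' =>
      s'.reg 35 = colorCount (s.reg 1) (s.mem 2) (fun _ => 1) (s.reg 30) := by
  refine Ends.seq_pow hW (Q := fun s' => s'.reg 35 = 0)
      (Ends.of_eval_pow 2 hW rfl (by decide) (by simp [eval]))
      fun s₁ hf₁ h₁ => Ends.loopUp_pow 1
        (fun j s' => s'.reg 35 = colorCount j (s.mem 2) (fun _ => 1) (s.reg 30)) rfl
        (hf₁.1 1 rfl) h hW (by simp [h₁, colorCount]) fun j _ s' hf hj hI => ?_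
  refine Ends.of_eval_pow 0 hW rfl (by decide) ?_
  have e30 : s'.reg 30 = s.reg 30 := (hf.1 30 rfl).trans (hf₁.1 30 rfl)
  have e1 : s'.mem 2 = s.mem 2 := (hf.2 2 rfl).trans (hf₁.2 2 rfl)
  simp only [colorCount, Finset.sum_range_succ] at hI ⊢
  simp only [eval, ifEq, skip, incr, State.reg_setReg, e30, e1, hj, hI,
    apply_ite State.reg, ite_apply]
  simp only [Nat.reduceEqDiff, if_true, if_false]
  split_ifs <;> omega

/-- Set `r₉ := 0` unless the colour `r₃₀` fits. Arrays `5` and `6` hold the selected and the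
dominated vertices. -/
def checkColor : Prog :=
  seq countMotif (seq (countMarked 5) (seq (ite 35 34 (const 9 0) skip)
    (seq (countMarked 6) (ite 34 35 (const 9 0) skip))))

/-- Register `9` is a flag that the tests can only lower, so successive tests accumulate to a
conjunction. -/
theorem checkColor_ends {s : State} {W : ℕ} (hW : 32 ≤ W) (h : s.reg 0 ≤ W) (h' : s.reg 1 ≤ W) :
    checkColor.Ends s (W ^ 8) fun s' => 0 < s'.reg 9 ↔ 0 < s.reg 9 ∧
      ColorFits (s.reg 0) (s.reg 1) (s.mem 1) (s.mem 2) (s.mem 5) (s.mem 6) (s.reg 30) := by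
  refine Ends.seq_pow hW ((countMotif_ends hW h').pow_mono hW (by omega)) fun s₁ f₁ h₁ => ?_
  refine Ends.seq_pow hW ((countMarked_ends 5 hW (by rwa [f₁.1 0 rfl])).pow_mono hW (by omega))
    fun s₂ f₂ h₂ => ?_
  refine Ends.seq_pow hW (ends_eval_pow 4 hW rfl (by decide)) fun s₃ f₃ h₃ => ?_
  refine Ends.seq_pow hW (countMarked_ends 6 hW (by rwa [f₃.1 0 rfl, f₂.1 0 rfl, f₁.1 0 rfl]))
    fun s₄ f₄ h₄ => Ends.of_eval_pow 3 hW rfl (by decide) ?_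
  have e9 : s₄.reg 9 = if s₂.reg 35 < s₂.reg 34 then 0 else s.reg 9 := by
    rw [f₄.1 9 rfl, h₃]
    simp only [eval, skip]
    split_ifs <;> simp [f₂.1 9 rfl, f₁.1 9 rfl]
  rw [h₂, f₂.1 35 rfl, h₁] at e9
  rw [f₃.1 30 rfl, f₂.1 30 rfl, f₁.1 30 rfl, f₃.1 0 rfl, f₂.1 0 rfl, f₁.1 0 rfl, f₃.2 1 rfl,
    f₂.2 1 rfl, f₁.2 1 rfl, f₃.2 6 rfl, f₂.2 6 rfl, f₁.2 6 rfl] at h₄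
  rw [f₁.1 30 rfl, f₁.1 0 rfl, f₁.2 1 rfl, f₁.2 5 rfl] at e9
  have e35 : s₄.reg 35 = _ := (f₄.1 35 rfl).trans ((f₃.1 35 rfl).trans ((f₂.1 35 rfl).trans h₁))
  simp only [eval, skip, h₄, e35, ColorFits]
  split_ifs with hlt
  · simp only [State.reg_setReg, if_true]
    omega
  · simp only [State.reg_setReg, Nat.reduceEqDiff, if_false, e9]
    split_ifs <;> omega

/-- Set `r₉ := 0` unless all colours of vertices and of elements of the motif fit. -/
def checkColors : Prog :=
  seq (loopUp 37 0 (seq (load 30 1 37) checkColor)) (loopUp 37 1 (seq (load 30 2 37) checkColor))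

/-- Colours are unbounded numbers, so one cannot loop over all of them; those that occur at a vertex
or in the motif suffice, as for any other colour all counts are `0`. -/
theorem checkColors_ends {s : State} {W : ℕ} (hW : 32 ≤ W) (h : s.reg 0 ≤ W) (h' : s.reg 1 ≤ W) :
    checkColors.Ends s (W ^ 12) fun s' => 0 < s'.reg 9 ↔ 0 < s.reg 9 ∧
      (∀ v < s.reg 0, ColorFits (s.reg 0) (s.reg 1) (s.mem 1) (s.mem 2) (s.mem 5) (s.mem 6)
        (s.mem 1 v)) ∧
      ∀ j < s.reg 1, ColorFits (s.reg 0) (s.reg 1) (s.mem 1) (s.mem 2) (s.mem 5) (s.mem 6)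
        (s.mem 2 j) := by
  refine Ends.seq_pow hW (Ends.loopUp_pow 9 (fun i s' => 0 < s'.reg 9 ↔ 0 < s.reg 9 ∧
      (∀ v < i, ColorFits (s.reg 0) (s.reg 1) (s.mem 1) (s.mem 2) (s.mem 5) (s.mem 6)
        (s.mem 1 v))) rfl rfl h hW (by simp) fun i _ s₁ f₁ hi hI => ?_) fun s₀ f₀ h₀ =>
    (Ends.loopUp_pow 9 (fun i s' => 0 < s'.reg 9 ↔ 0 < s₀.reg 9 ∧
      (∀ v < i, ColorFits (s.reg 0) (s.reg 1) (s.mem 1) (s.mem 2) (s.mem 5) (s.mem 6)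
        (s.mem 2 v))) rfl (f₀.1 1 rfl) h' hW (by simp) fun i _ s₁ f₁ hi hI => ?_).imp
      fun s' _ hs' => by rw [hs', h₀, and_assoc]
  · refine Ends.seq_pow hW (ends_eval_pow 7 hW rfl (by decide)) fun s₂ f₂ h₂ => ?_
    refine (checkColor_ends hW (by rwa [f₂.1 0 rfl, f₁.1 0 rfl])
      (by rwa [f₂.1 1 rfl, f₁.1 1 rfl])).imp fun s₃ f₃ h₃ => ?_
    have e30 : s₂.reg 30 = s.mem 1 i := by rw [h₂]; simp [eval, hi, f₁.2 1 rfl]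
    rw [e30, f₂.1 9 rfl, hI, f₂.1 0 rfl, f₁.1 0 rfl, f₂.1 1 rfl, f₁.1 1 rfl, f₂.2 1 rfl, f₁.2 1 rfl,
      f₂.2 2 rfl, f₁.2 2 rfl, f₂.2 5 rfl, f₁.2 5 rfl, f₂.2 6 rfl, f₁.2 6 rfl] at h₃
    simp only [State.reg_setReg, Nat.reduceEqDiff, if_false, h₃, Nat.lt_succ_iff_lt_or_eq,
      or_imp, forall_and, forall_eq, and_assoc]
  · refine Ends.seq_pow hW (ends_eval_pow 7 hW rfl (by decide)) fun s₂ f₂ h₂ => ?_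
    refine (checkColor_ends hW (by rwa [f₂.1 0 rfl, f₁.1 0 rfl, f₀.1 0 rfl])
      (by rwa [f₂.1 1 rfl, f₁.1 1 rfl, f₀.1 1 rfl])).imp fun s₃ f₃ h₃ => ?_
    have e30 : s₂.reg 30 = s.mem 2 i := by rw [h₂]; simp [eval, hi, f₁.2 2 rfl, f₀.2 2 rfl]
    rw [e30, f₂.1 9 rfl, hI, f₂.1 0 rfl, f₁.1 0 rfl, f₂.1 1 rfl, f₁.1 1 rfl, f₂.2 1 rfl, f₁.2 1 rfl,
      f₂.2 2 rfl, f₁.2 2 rfl, f₂.2 5 rfl, f₁.2 5 rfl, f₂.2 6 rfl, f₁.2 6 rfl, f₀.1 0 rfl,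
      f₀.1 1 rfl, f₀.2 1 rfl, f₀.2 2 rfl, f₀.2 5 rfl, f₀.2 6 rfl] at h₃
    simp only [State.reg_setReg, Nat.reduceEqDiff, if_false, h₃, Nat.lt_succ_iff_lt_or_eq,
      or_imp, forall_and, forall_eq, and_assoc]

/-! ### Selecting a sequence of vertices -/

/-- `r₁₀ := r₈ / r₀` and `r₈ := r₈ % r₀`, for `r₈ < r₆`. -/
def divide : Prog :=
  seq (const 10 0) (loopUp 11 6 (ite 8 0 skip (seq (sub 8 8 0) (incr 10))))

theorem divide_ends {s : State} {W : ℕ} (hW : 32 ≤ W) (h0 : 0 < s.reg 0) (h6 : s.reg 6 ≤ W)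
    (h8 : s.reg 8 < s.reg 6) :
    divide.Ends s (W ^ 4) fun s' =>
      s'.reg 10 = s.reg 8 / s.reg 0 ∧ s'.reg 8 = s.reg 8 % s.reg 0 := by
  refine Ends.seq_pow hW (ends_eval_pow 2 hW rfl (by decide)) fun s₁ f₁ h₁ =>
    (Ends.loopUp_pow 1 (fun j s' => s.reg 8 = s'.reg 8 + s'.reg 10 * s.reg 0 ∧
      (s'.reg 8 < s.reg 0 ∨ s'.reg 10 = j)) rfl (f₁.1 6 rfl) h6 hW (by simp [h₁, eval])
      fun j _ s₂ f₂ hj hI => Ends.of_eval_pow 0 hW rfl (by decide) ?_).imp fun s₂ f₂ h₂ => ?_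
  · have e0 : s₂.reg 0 = s.reg 0 := (f₂.1 0 rfl).trans (f₁.1 0 rfl)
    simp only [eval, skip, incr, e0]
    split_ifs with hlt
    · simpa [hlt] using hI.1
    · simp only [State.reg_setReg, Nat.reduceEqDiff, if_false, if_true]
      have : s₂.reg 10 = j := by omega
      rw [add_mul]
      omega
  · obtain ⟨e, hlt⟩ := h₂
    have hlt : s₂.reg 8 < s.reg 0 := by
      -- Had all `r₆` rounds subtracted, the quotient would be `r₆`, and `r₆ ≤ r₆ * r₀ ≤ r₈` would
      -- contradict `r₈ < r₆`.
      refine hlt.resolve_right fun h => ?_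
      have := Nat.le_mul_of_pos_right (s₂.reg 10) h0
      omega
    constructor
    · rw [e, Nat.add_mul_div_right _ _ h0, Nat.div_eq_of_lt hlt, zero_add]
    · rw [e, Nat.add_mul_mod_self_right, Nat.mod_eq_of_lt hlt]

/-- Select the vertex `r₈`; set `r₉ := 0` if `0 < r₁₃` and the vertex is not yet dominated. -/
def markVertex : Prog :=
  seq (load 12 6 8) (seq (const 98 1) (seq (ifPos 13 (ite 12 98 (const 9 0) skip))
    (seq (const 98 1) (seq (store 5 8 98) (store 6 8 98)))))

/-- Register `13` will be the position in the sequence; at position `0` there is no earlier vertex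
to touch, so the test is waived. -/
theorem markVertex_ends {s : State} {W : ℕ} (hW : 32 ≤ W) :
    markVertex.Ends s (W ^ 4) fun s' =>
      (s'.reg 9 = if 0 < s.reg 13 ∧ s.mem 6 (s.reg 8) = 0 then 0 else s.reg 9) ∧
      (∀ v, s'.mem 5 v = if v = s.reg 8 then 1 else s.mem 5 v) ∧
      ∀ v, s'.mem 6 v = if v = s.reg 8 then 1 else s.mem 6 v := by
  refine Ends.of_eval_pow 3 hW rfl (by decide) ?_
  by_cases h : 0 < s.reg 13 <;> by_cases h' : s.mem 6 (s.reg 8) = 0 <;>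
    simp [markVertex, eval, skip, ifPos, h, h']

/-- Mark the neighbours of the vertex `r₈` as dominated, for the adjacency matrix in array `A`. -/
def markNeighbours (A : ℕ) : Prog :=
  loopUp 14 0 (seq (copy 22 8) (seq (copy 23 14) (seq mulAdd
    (seq (load 15 A 20) (seq (const 98 1) (ifPos 15 (store 6 14 98)))))))

theorem markNeighbours_ends {A : ℕ} (hA : A ≠ 6) {s : State} {W : ℕ} (hW : 32 ≤ W)
    (h : s.reg 0 ≤ W) (h8 : s.reg 8 < s.reg 0) :
    (markNeighbours A).Ends s (W ^ 10) fun s' => ∀ v, s'.mem 6 v =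
      if v < s.reg 0 ∧ 0 < s.mem A (s.reg 8 * s.reg 0 + v) then 1 else s.mem 6 v := by
  refine Ends.loopUp_pow 8 (fun j s' => ∀ v, s'.mem 6 v =
      if v < j ∧ 0 < s.mem A (s.reg 8 * s.reg 0 + v) then 1 else s.mem 6 v) rfl rfl h hW
      (by simp) fun j hj s₁ f₁ ej hI => ?_
  refine Ends.seq_pow hW (ends_eval_pow 6 hW rfl (by decide)) fun s₂ f₂ h₂ => ?_
  refine Ends.seq_pow hW (ends_eval_pow 5 hW rfl (by decide)) fun s₃ f₃ h₃ => ?_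
  have e22 : s₃.reg 22 = s.reg 8 := by
    rw [f₃.1 22 rfl, h₂]; simp [eval, copy, f₁.1 8 rfl]
  have e23 : s₃.reg 23 = j := by
    rw [h₃]; simp [eval, copy, f₂.1 14 rfl, ej]
  refine Ends.seq_pow hW (mulAdd_ends hW (by rw [e22]; omega)) fun s₄ f₄ h₄ =>
    Ends.of_eval_pow 4 hW rfl (by simp [ifPos, skip, size]) ?_
  rw [e22, e23, f₃.1 0 rfl, f₂.1 0 rfl, f₁.1 0 rfl] at h₄
  have hAs : (markNeighbours A).stores A = false := by
    simp [markNeighbours, stores, loopUp, copy, mulAdd, ifPos, skip, hA]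
  have eA : s₄.mem A = s.mem A := by
    rw [f₄.2 A rfl, f₃.2 A rfl, f₂.2 A rfl, f₁.2 A hAs]
  have e6 : s₄.mem 6 = s₁.mem 6 := by
    rw [f₄.2 6 rfl, f₃.2 6 rfl, f₂.2 6 rfl]
  have e14 : s₄.reg 14 = j := by
    rw [f₄.1 14 rfl, f₃.1 14 rfl, f₂.1 14 rfl, ej]
  intro v
  by_cases hp : 0 < s.mem A (s.reg 8 * s.reg 0 + j)
  · by_cases hv : v = j
    · subst hv; simp [eval, ifPos, skip, h₄, eA, hp, e14]
    · have : v < j + 1 ↔ v < j := by omega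
      simp [eval, ifPos, skip, h₄, eA, hp, e14, e6, hI, hv, this]
  · by_cases hv : v = j
    · subst hv
      simp [eval, ifPos, skip, h₄, eA, hp, e6, hI]
    · have : v < j + 1 ↔ v < j := by omega
      simp [eval, ifPos, skip, h₄, eA, hp, e6, hI, this]

/-- Select the vertex `r₈ % r₀`, mark its neighbours as dominated, and set `r₈ := r₈ / r₀`. -/
def visit (A : ℕ) : Prog :=
  seq divide (seq markVertex (seq (markNeighbours A) (copy 8 10)))

theorem visit_ends {A : ℕ} (hA : A ≠ 6) (hA' : A ≠ 5) {s : State} {W : ℕ} (hW : 32 ≤ W)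
    (h : s.reg 0 ≤ W) (h0 : 0 < s.reg 0) (h6 : s.reg 6 ≤ W) (h8 : s.reg 8 < s.reg 6) :
    (visit A).Ends s (W ^ 13) fun s' =>
      s'.reg 8 = s.reg 8 / s.reg 0 ∧
      (s'.reg 9 = if 0 < s.reg 13 ∧ s.mem 6 (s.reg 8 % s.reg 0) = 0 then 0 else s.reg 9) ∧
      (∀ v, s'.mem 5 v = if v = s.reg 8 % s.reg 0 then 1 else s.mem 5 v) ∧
      ∀ v < s.reg 0, s'.mem 6 v = if s.reg 8 % s.reg 0 = v ∨
        0 < s.mem A (s.reg 8 % s.reg 0 * s.reg 0 + v) then 1 else s.mem 6 v := by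
  refine Ends.seq_pow hW ((divide_ends hW h0 h6 h8).pow_mono hW (by omega)) fun s₁ f₁ h₁ => ?_
  refine Ends.seq_pow hW ((markVertex_ends hW).pow_mono hW (by omega)) fun s₂ f₂ h₂ => ?_
  have e0 : s₂.reg 0 = s.reg 0 := by rw [f₂.1 0 rfl, f₁.1 0 rfl]
  have e8 : s₂.reg 8 = s.reg 8 % s.reg 0 := by rw [f₂.1 8 rfl, h₁.2]
  refine Ends.seq_pow hW (markNeighbours_ends hA hW (by rwa [e0])
    (by rw [e0, e8]; exact Nat.mod_lt _ h0)) fun s₃ f₃ h₃ =>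
      Ends.of_eval_pow 9 hW rfl (by decide) ?_
  have e10 : s₃.reg 10 = s.reg 8 / s.reg 0 := by rw [f₃.1 10 rfl, f₂.1 10 rfl, h₁.1]
  have eA : s₂.mem A = s.mem A := by
    rw [f₂.2 A (by simp [markVertex, stores, ifPos, skip, hA, hA']), f₁.2 A rfl]
  rw [e8, eA, e0] at h₃
  rw [f₁.1 13 rfl, f₁.2 6 rfl, h₁.2, f₁.1 9 rfl, f₁.2 5 rfl] at h₂
  obtain ⟨h9, h5, h6⟩ := h₂
  have e9 : s₃.reg 9 = _ := (f₃.1 9 rfl).trans h9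
  have e5 : s₃.mem 5 = s₂.mem 5 := f₃.2 5 rfl
  refine ⟨by simp [eval, copy, e10], by simp [eval, copy, e9], by simp [eval, copy, e5, h5],
    fun v hv => ?_⟩
  simp only [eval, copy, State.mem_setReg, h₃, h6, hv, true_and, @eq_comm _ v]
  split_ifs <;> tauto

end Prog

/-! ### Indicators and the acceptance test for a sequence -/

open Classical in
/-- The indicator of a proposition. -/
noncomputable def ind (P : Prop) : ℕ := if P then 1 else 0

theorem ind_of {P : Prop} (h : P) : ind P = 1 := by simp [ind, h]

theorem ind_of_not {P : Prop} (h : ¬ P) : ind P = 0 := by simp [ind, h]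

theorem ind_eq_zero {P : Prop} : ind P = 0 ↔ ¬ P := by
  by_cases h : P <;> simp [ind, h]

theorem ite_ind {P Q R : Prop} [Decidable P] (h : R ↔ P ∨ Q) :
    (if P then 1 else ind Q) = ind R := by
  by_cases hP : P <;> by_cases hQ : Q <;> simp [ind, h, hP, hQ]

theorem colorCount_congr {n : ℕ} {c g g' : ℕ → ℕ} (h : ∀ v < n, g v = g' v) (x : ℕ) :
    colorCount n c g x = colorCount n c g' x :=
  Finset.sum_congr rfl fun v hv => by rw [h v (Finset.mem_range.1 hv)]

/-- `u` and `v` are equal or adjacent in the graph with `n × n` adjacency matrix `a`. -/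
def Touch (n : ℕ) (a : ℕ → ℕ) (u v : ℕ) : Prop := u = v ∨ 0 < a (u * n + v)

/-- The test for a sequence `r` of `k` vertices: each one but the first touches an earlier one, and
the motif is between the colours of the sequence and those of the vertices it touches. -/
def Accepts (n m k : ℕ) (c μ a r : ℕ → ℕ) : Prop :=
  (∀ j < k, 0 < j → ∃ i < j, Touch n a (r i) (r j)) ∧
  (∀ v < n, ColorFits n m c μ (fun v => ind (∃ i < k, r i = v))
    (fun v => ind (∃ i < k, Touch n a (r i) v)) (c v)) ∧
  ∀ j < m, ColorFits n m c μ (fun v => ind (∃ i < k, r i = v))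
    (fun v => ind (∃ i < k, Touch n a (r i) v)) (μ j)

/-- The `i`-th digit of `N` in base `n`. -/
def digit (n N i : ℕ) : ℕ := N / n ^ i % n

namespace Prog

/-- Select the vertices given by the first `r₅` digits of `r₈` in base `r₀`. -/
def visitAll (A : ℕ) : Prog := loopUp 13 5 (visit A)

/-- Before round `k`, array `6` marks exactly the vertices touched by the first `k` digits. Its
entry at digit `k` thus decides whether that digit touches an earlier one. -/
theorem visitAll_ends {A : ℕ} (hA : A ≠ 6) (hA' : A ≠ 5) {s : State} {W n N : ℕ} (hW : 32 ≤ W)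
    (e0 : s.reg 0 = n) (h : n ≤ W) (h0 : 0 < n) (h5 : s.reg 5 ≤ W) (h6 : s.reg 6 ≤ W)
    (e8 : s.reg 8 = N) (h8 : N < s.reg 6) (h9 : s.reg 9 = 1) (m5 : ∀ v < n, s.mem 5 v = 0)
    (m6 : ∀ v < n, s.mem 6 v = 0) :
    (visitAll A).Ends s (W ^ 15) fun s' =>
      (0 < s'.reg 9 ↔ ∀ j < s.reg 5, 0 < j →
        ∃ i < j, Touch n (s.mem A) (digit n N i) (digit n N j)) ∧
      (∀ v < n, s'.mem 5 v = ind (∃ i < s.reg 5, digit n N i = v)) ∧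
      ∀ v < n, s'.mem 6 v = ind (∃ i < s.reg 5, Touch n (s.mem A) (digit n N i) v) := by
  refine (Ends.loopUp_pow 13 (fun k s' => s'.reg 8 = N / n ^ k ∧ (0 < s'.reg 9 ↔ ∀ j < k, 0 < j →
        ∃ i < j, Touch n (s.mem A) (digit n N i) (digit n N j)) ∧
      (∀ v < n, s'.mem 5 v = ind (∃ i < k, digit n N i = v)) ∧
      ∀ v < n, s'.mem 6 v = ind (∃ i < k, Touch n (s.mem A) (digit n N i) v)) rfl rfl h5 hW ?_
      fun k hk s₁ f₁ ek hI => ?_).imp fun s' _ hs' => hs'.2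
  · simp +contextual [h9, e8, m5, m6, ind]
  · obtain ⟨i8, i9, i5, i6⟩ := hI
    have eA : s₁.mem A = s.mem A := f₁.2 A (by
      simp [visit, markNeighbours, markVertex, divide, stores, loopUp, copy, mulAdd, ifPos, skip,
        incr, hA, hA'])
    have e0' : s₁.reg 0 = n := (f₁.1 0 rfl).trans e0
    have e6' : s₁.reg 6 = s.reg 6 := f₁.1 6 rfl
    have hd : s₁.reg 8 % s₁.reg 0 = digit n N k := by rw [i8, e0', digit]
    have hdn : digit n N k < n := Nat.mod_lt _ h0
    refine (visit_ends hA hA' hW (by rwa [e0']) (by rwa [e0']) (by rwa [e6']) (by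
      rw [e6', i8]; exact (Nat.div_le_self _ _).trans_lt h8)).imp fun s₂ f₂ h₂ => ?_
    rw [hd, e0', eA, ek, i6 _ hdn] at h₂
    obtain ⟨j8, j9, j5, j6⟩ := h₂
    refine ⟨?_, ?_, fun v hv => ?_, fun v hv => ?_⟩
    · simp [j8, i8, Nat.div_div_eq_div_mul, pow_succ]
    · simp only [State.reg_setReg, Nat.reduceEqDiff, if_false, j9]
      constructor
      · intro hp j hj hj0
        split_ifs at hp with hc
        · simp at hp
        · rcases Nat.lt_succ_iff_lt_or_eq.1 hj with hj | rfl
          · exact i9.1 hp j hj hj0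
          · by_contra hne
            exact hc ⟨hj0, ind_eq_zero.2 hne⟩
      · intro hp
        rw [if_neg fun hc => ind_eq_zero.1 hc.2 (hp k (by omega) hc.1)]
        exact i9.2 fun j hj => hp j (by omega)
    · simp only [State.mem_setReg, j5, i5 v hv]
      refine ite_ind ?_
      simp only [Nat.lt_succ_iff_lt_or_eq, or_and_right, exists_or, exists_eq_left]
      rw [or_comm, @eq_comm _ v]
    · simp only [State.mem_setReg, j6 v hv, i6 v hv]
      refine ite_ind ?_
      simp only [Nat.lt_succ_iff_lt_or_eq, or_and_right, exists_or, exists_eq_left]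
      rw [or_comm, Touch]

/-- Remove all marks of vertices. -/
def clear : Prog := loopUp 40 0 (seq (const 97 0) (seq (store 5 40 97) (store 6 40 97)))

theorem clear_ends {s : State} {W : ℕ} (hW : 32 ≤ W) (h : s.reg 0 ≤ W) :
    clear.Ends s (W ^ 3) fun s' => ∀ v < s.reg 0, s'.mem 5 v = 0 ∧ s'.mem 6 v = 0 := by
  refine Ends.loopUp_pow 1 (fun j s' => ∀ v < j, s'.mem 5 v = 0 ∧ s'.mem 6 v = 0) rfl rfl h hW
    (by simp) fun j _ s' f ej hI => Ends.of_eval_pow 0 hW rfl (by decide) fun v hv => ?_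
  by_cases h : v = j
  · simp [eval, ej, h]
  · simp [eval, ej, h, hI v (by omega)]

/-- Set `r₄ := 1` if the sequence of the first `r₅` digits of `r₇` is accepted. -/
def tryCandidate (A : ℕ) : Prog :=
  seq (seq (copy 8 7) (const 9 1)) (seq clear (seq (visitAll A)
    (seq checkColors (ifPos 9 (const 4 1)))))

theorem stores_tryCandidate {A : ℕ} (hA : A ≠ 6) (hA' : A ≠ 5) :
    (tryCandidate A).stores A = false := by
  simp [tryCandidate, checkColors, checkColor, countMotif, countMarked, ifEq, clear, visitAll,
    visit, markNeighbours, markVertex, divide, stores, loopUp, copy, mulAdd, ifPos, skip, incr, hA,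
    hA']

open Classical in
-- Register `4` is only ever raised, so that over all candidates it becomes an existential
-- quantifier.
theorem tryCandidate_ends {A : ℕ} (hA : A ≠ 6) (hA' : A ≠ 5) {s : State} {W n m k N : ℕ}
    (hW : 32 ≤ W) (e0 : s.reg 0 = n) (h : n ≤ W) (h0 : 0 < n) (e1 : s.reg 1 = m) (h1 : m ≤ W)
    (e5 : s.reg 5 = k) (h5 : k ≤ W) (h6 : s.reg 6 ≤ W) (e7 : s.reg 7 = N) (h7 : N < s.reg 6) :
    (tryCandidate A).Ends s (W ^ 18) fun s' => s'.reg 4 =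
      if Accepts n m k (s.mem 1) (s.mem 2) (s.mem A) (digit n N) then 1 else s.reg 4 := by
  refine Ends.seq_pow hW (ends_eval_pow 16 hW rfl (by decide)) fun s₁ f₁ h₁ => ?_
  refine Ends.seq_pow hW ((clear_ends hW (by rwa [f₁.1 0 rfl, e0])).pow_mono hW (by omega))
    fun s₂ f₂ h₂ => ?_
  have hA2 : s₂.mem A = s.mem A :=
    (f₂.2 A (by simp [clear, stores, loopUp, hA, hA'])).trans (f₁.2 A rfl)
  rw [f₁.1 0 rfl, e0] at h₂
  refine Ends.seq_pow hW (visitAll_ends (n := n) (N := N) hA hA' hW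
    (by rw [f₂.1 0 rfl, f₁.1 0 rfl, e0]) h h0 (by rwa [f₂.1 5 rfl, f₁.1 5 rfl, e5])
    (by rwa [f₂.1 6 rfl, f₁.1 6 rfl]) (by rw [f₂.1 8 rfl, h₁]; simp [eval, copy, e7])
    (by rwa [f₂.1 6 rfl, f₁.1 6 rfl]) (by rw [f₂.1 9 rfl, h₁]; simp [eval])
    (fun v hv => (h₂ v hv).1) fun v hv => (h₂ v hv).2) fun s₃ f₃ h₃ => ?_
  rw [hA2, f₂.1 5 rfl, f₁.1 5 rfl, e5] at h₃
  obtain ⟨i9, i5, i6⟩ := h₃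
  refine Ends.seq_pow hW ((checkColors_ends hW (by rwa [f₃.1 0 rfl, f₂.1 0 rfl, f₁.1 0 rfl, e0])
    (by rwa [f₃.1 1 rfl, f₂.1 1 rfl, f₁.1 1 rfl, e1])).pow_mono hW (by omega)) fun s₄ f₄ h₄ =>
      Ends.of_eval_pow 13 hW rfl (by decide) ?_
  have e4 : s₄.reg 4 = s.reg 4 := by rw [f₄.1 4 rfl, f₃.1 4 rfl, f₂.1 4 rfl, f₁.1 4 rfl]
  rw [f₃.1 0 rfl, f₂.1 0 rfl, f₁.1 0 rfl, e0, f₃.1 1 rfl, f₂.1 1 rfl, f₁.1 1 rfl, e1, f₃.2 1 rfl,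
    f₂.2 1 rfl, f₁.2 1 rfl, f₃.2 2 rfl, f₂.2 2 rfl, f₁.2 2 rfl, i9] at h₄
  have key : 0 < s₄.reg 9 ↔ Accepts n m k (s.mem 1) (s.mem 2) (s.mem A) (digit n N) := by
    simpa only [Accepts, ColorFits, colorCount_congr i5, colorCount_congr i6] using h₄
  by_cases hacc : Accepts n m k (s.mem 1) (s.mem 2) (s.mem A) (digit n N)
  · simp [eval, ifPos, key.2 hacc, hacc]
  · simp [eval, ifPos, skip, Nat.eq_zero_of_not_pos fun hh => hacc (key.1 hh), hacc, e4]

/-! ### Enumeration of all candidate sequences -/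

/-- Set `r₄ := 1` if the sequence of the first `r₅` digits of some number below `r₆` is
accepted. -/
def search (A : ℕ) : Prog := loopUp 7 6 (tryCandidate A)

open Classical in
theorem search_ends {A : ℕ} (hA : A ≠ 6) (hA' : A ≠ 5) {s : State} {W n m k : ℕ}
    (hW : 32 ≤ W) (e0 : s.reg 0 = n) (h : n ≤ W) (h0 : 0 < n) (e1 : s.reg 1 = m) (h1 : m ≤ W)
    (e4 : s.reg 4 = 0) (e5 : s.reg 5 = k) (h5 : k ≤ W) (h6 : s.reg 6 ≤ W) :
    (search A).Ends s (W ^ 20) fun s' => s'.reg 4 =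
      ind (∃ N < s.reg 6, Accepts n m k (s.mem 1) (s.mem 2) (s.mem A) (digit n N)) := by
  refine Ends.loopUp_pow 18 (fun j s' => s'.reg 4 =
      ind (∃ N < j, Accepts n m k (s.mem 1) (s.mem 2) (s.mem A) (digit n N))) rfl rfl h6 hW
      (by simp [e4, ind]) fun j hj s₁ f₁ ej hI => ?_
  refine (tryCandidate_ends hA hA' hW ((f₁.1 0 rfl).trans e0) h h0 ((f₁.1 1 rfl).trans e1) h1
    ((f₁.1 5 rfl).trans e5) h5 (by rwa [f₁.1 6 rfl]) ej (by rwa [f₁.1 6 rfl])).imp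
    fun s₂ f₂ h₂ => ?_
  rw [f₁.2 1 rfl, f₁.2 2 rfl,
    f₁.2 A (by simpa [loopUp, stores] using stores_tryCandidate hA hA'), hI] at h₂
  simp only [State.reg_setReg, Nat.reduceEqDiff, if_false, h₂]
  refine ite_ind ?_
  simp only [Nat.lt_succ_iff_lt_or_eq, or_and_right, exists_or, exists_eq_left]
  rw [or_comm]

/-! ### The number of candidates and the number of divisors -/

/-- `r₆ := r₀ ^ r₅` -/
def power : Prog :=
  seq (const 6 1) (loopUp 16 5 (seq (const 17 0) (seq (loopUp 18 0 (add 17 17 6)) (copy 6 17))))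

theorem power_ends {s : State} {W : ℕ} (hW : 32 ≤ W) (h : s.reg 0 ≤ W) (h5 : s.reg 5 ≤ W) :
    power.Ends s (W ^ 8) fun s' => s'.reg 6 = s.reg 0 ^ s.reg 5 := by
  refine Ends.seq_pow hW (ends_eval_pow 6 hW rfl (by decide)) fun s₁ f₁ h₁ =>
    Ends.loopUp_pow 5 (fun j s' => s'.reg 6 = s.reg 0 ^ j) rfl (f₁.1 5 rfl) h5 hW
      (by simp [h₁, eval]) fun j _ s₂ f₂ ej hI => ?_
  refine Ends.seq_pow hW (ends_eval_pow 3 hW rfl (by decide)) fun s₃ f₃ h₃ => ?_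
  refine Ends.seq_pow hW (Ends.loopUp_pow 1 (fun i s' => s'.reg 17 = i * s.reg 0 ^ j) rfl
    (by rw [f₃.1 0 rfl, f₂.1 0 rfl, f₁.1 0 rfl]) h hW (by simp [h₃, eval]) fun i _ s₄ f₄ _ hi =>
      Ends.of_eval_pow 0 hW rfl (by decide) ?_) fun s₄ f₄ h₄ =>
        Ends.of_eval_pow 2 hW rfl (by decide) ?_
  · simp [eval, hi, f₄.1 6 rfl, f₃.1 6 rfl, hI, add_mul]
  · simp [eval, copy, h₄, pow_succ, mul_comm]

/-- Compute in `r₅` the number of divisors of `r₀`. -/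
def countDivisors : Prog :=
  seq (const 5 0) (loopUp 16 0 (seq (seq (const 98 1) (seq (add 17 16 98) (const 18 0)))
    (loopUp 19 0 (seq (add 18 18 17) (ifEq 18 0 (incr 5))))))

/-- This is the count made by two nested loops that look for `n` among the multiples of `d + 1`; the
shifts by one come from counters that start at `0`. Each divisor is counted once because its
cofactor is unique. -/
theorem _root_.Nat.card_divisors_eq_sum (n : ℕ) :
    n.divisors.card = ∑ d ∈ Finset.range n, ∑ e ∈ Finset.range n,
      if (e + 1) * (d + 1) = n then 1 else 0 := by
  have h : ∀ d ∈ Finset.range n, (∑ e ∈ Finset.range n, if (e + 1) * (d + 1) = n then 1 else 0) =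
      if d + 1 ∣ n then 1 else 0 := by
    intro d hd
    have hn : 0 < n := by have := Finset.mem_range.1 hd; omega
    split_ifs with hdvd
    · obtain ⟨q, hq⟩ := hdvd
      have hq0 : 0 < q := Nat.pos_of_ne_zero (by rintro rfl; simp at hq; omega)
      have hqn : q ≤ n := Nat.le_of_dvd hn ⟨d + 1, by rw [hq, mul_comm]⟩
      rw [Finset.sum_eq_single_of_mem (q - 1) (Finset.mem_range.2 (by omega))]
      · rw [if_pos]; rw [Nat.sub_add_cancel hq0, hq, mul_comm]
      · intro e _ he
        refine if_neg fun h => he ?_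
        have : (e + 1) * (d + 1) = q * (d + 1) := by rw [h]; rw [hq]; ring
        have := Nat.eq_of_mul_eq_mul_right (Nat.succ_pos d) this
        omega
    · exact Finset.sum_eq_zero fun e _ => if_neg fun h => hdvd ⟨e + 1, by rw [← h, mul_comm]⟩
  rw [Finset.sum_congr rfl h, Nat.divisors, Finset.card_filter, Finset.sum_Ico_eq_sum_range]
  simp [add_comm]

theorem countDivisors_ends {s : State} {W : ℕ} (hW : 32 ≤ W) (h : s.reg 0 ≤ W) :
    countDivisors.Ends s (W ^ 7) fun s' => s'.reg 5 = (s.reg 0).divisors.card := by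
  refine Ends.seq_pow hW (ends_eval_pow 5 hW rfl (by decide)) fun s₁ f₁ h₁ =>
    (Ends.loopUp_pow 4 (fun j s' => s'.reg 5 = ∑ d ∈ Finset.range j, ∑ e ∈ Finset.range (s.reg 0),
      if (e + 1) * (d + 1) = s.reg 0 then 1 else 0) rfl (f₁.1 0 rfl) h hW
      (by simp [h₁, eval]) fun j _ s₂ f₂ ej hI => ?_).imp fun s' _ h' => by
        rw [h', ← Nat.card_divisors_eq_sum]
  refine Ends.seq_pow hW (ends_eval_pow 2 hW rfl (by decide)) fun s₃ f₃ h₃ => ?_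
  have e0 : s₃.reg 0 = s.reg 0 := by rw [f₃.1 0 rfl, f₂.1 0 rfl, f₁.1 0 rfl]
  refine (Ends.loopUp_pow 1 (fun i s' => s'.reg 18 = i * (j + 1) ∧
    s'.reg 5 = (∑ d ∈ Finset.range j, ∑ e ∈ Finset.range (s.reg 0),
      if (e + 1) * (d + 1) = s.reg 0 then 1 else 0) + ∑ e ∈ Finset.range i,
      if (e + 1) * (j + 1) = s.reg 0 then 1 else 0) rfl e0 h hW ?_ fun i _ s₄ f₄ _ hi =>
      Ends.of_eval_pow 0 hW rfl (by decide) ?_).imp fun s₄ f₄ h₄ => ?_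
  · simp [h₃, eval, hI]
  · have e17 : s₄.reg 17 = j + 1 := by rw [f₄.1 17 rfl, h₃]; simp [eval, ej]
    have e0' : s₄.reg 0 = s.reg 0 := by rw [f₄.1 0 rfl, e0]
    rw [Finset.sum_range_succ _ i]
    obtain ⟨i18, i5⟩ := hi
    rcases lt_trichotomy ((i + 1) * (j + 1)) (s.reg 0) with hlt | heq | hgt
    · simp [eval, ifEq, skip, i18, e17, e0', i5, ← add_one_mul, hlt, hlt.ne]
    · simp [eval, ifEq, skip, incr, i18, e17, e0', i5, ← add_one_mul, heq, add_assoc]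
    · simp [eval, ifEq, skip, i18, e17, e0', i5, ← add_one_mul, hgt, hgt.ne', hgt.not_gt]
  · simp [h₄.2, Finset.sum_range_succ _ j]

/-! ### The complete algorithm -/

/-- The algorithm for Graph Motif, for the adjacency matrix in array `A`. -/
def solve (A : ℕ) : Prog :=
  seq (const 4 0) (seq (ite 0 1 skip (seq countDivisors (seq power (search A)))) (copy 0 4))

/-- Motifs with more than `n` elements are rejected at once; otherwise the time would depend on the
length of the motif and not on `n` alone. -/
theorem solve_ends {A : ℕ} (hA : A ≠ 6) (hA' : A ≠ 5) {s : State} {n m W : ℕ}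
    (hn : 0 < n) (e0 : s.reg 0 = n) (e1 : s.reg 1 = m) (hW : 32 ≤ W)
    (hnW : n ^ n.divisors.card ≤ W) :
    (solve A).Ends s (W ^ 25) fun s' => s'.reg 0 = ind (m ≤ n ∧ ∃ N < n ^ n.divisors.card,
      Accepts n m n.divisors.card (s.mem 1) (s.mem 2) (s.mem A) (digit n N)) := by
  have hd : n.divisors.card ≠ 0 := by simp [hn.ne']
  have h : n ≤ W := (Nat.le_self_pow hd n).trans hnW
  refine Ends.seq_pow hW (ends_eval_pow 23 hW rfl (by decide)) fun s₁ f₁ h₁ => ?_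
  have e0₁ : s₁.reg 0 = n := (f₁.1 0 rfl).trans e0
  have e1₁ : s₁.reg 1 = m := (f₁.1 1 rfl).trans e1
  have e4₁ : s₁.reg 4 = 0 := by simp [h₁, eval]
  have hlt : 1 + W ^ 22 ≤ W ^ 23 := by
    have : W ^ 22 * 2 ≤ W ^ 22 * W := by gcongr; omega
    have : 1 ≤ W ^ 22 := Nat.one_le_pow _ _ (by omega)
    have : W ^ 23 = W ^ 22 * W := pow_succ _ _
    omega
  refine Ends.seq_pow hW (Q := fun s' => s'.reg 4 = ind (m ≤ n ∧ ∃ N < n ^ n.divisors.card,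
      Accepts n m n.divisors.card (s.mem 1) (s.mem 2) (s.mem A) (digit n N)))
    ((Ends.ite (fun hc => Ends.of_eval_pow 21 hW rfl (by decide) ?_) fun hc => ?_).mono hlt)
    fun s₂ f₂ h₂ => Ends.of_eval_pow 22 hW rfl (by decide) (by simp [eval, copy, h₂])
  · rw [ind_of_not fun hmn => by rw [e0₁, e1₁] at hc; exact hc.not_ge hmn.1]
    simp [eval, skip, e4₁]
  · refine Ends.seq_pow hW ((countDivisors_ends hW (by rwa [e0₁])).pow_mono hW (by omega))
      fun s₂ f₂ h₂ => ?_
    rw [e0₁] at h₂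
    have e0₂ : s₂.reg 0 = n := by rw [f₂.1 0 rfl, e0₁]
    have hdn : n.divisors.card ≤ W := (Nat.card_divisors_le_self n).trans h
    refine Ends.seq_pow hW ((power_ends hW (by rwa [e0₂]) (by rwa [h₂])).pow_mono hW (by omega))
      fun s₃ f₃ h₃ => ?_
    rw [e0₂, h₂] at h₃
    refine (search_ends hA hA' hW (by rw [f₃.1 0 rfl, e0₂]) h hn
      (by rw [f₃.1 1 rfl, f₂.1 1 rfl, e1₁]) (by rw [e0₁, e1₁] at hc; omega)
      (by rw [f₃.1 4 rfl, f₂.1 4 rfl, e4₁])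
      (by rw [f₃.1 5 rfl, h₂]) hdn (by rwa [h₃])).imp fun s₄ f₄ h₄ => ?_
    rw [h₄, h₃, f₃.2 1 rfl, f₂.2 1 rfl, f₁.2 1 rfl, f₃.2 2 rfl, f₂.2 2 rfl, f₁.2 2 rfl, f₃.2 A rfl,
      f₂.2 A rfl, f₁.2 A rfl]
    have hmn : m ≤ n := by rw [e0₁, e1₁] at hc; omega
    simp [hmn]

/-! ### From a Cayley table to the adjacency matrix -/

/-- The element reached from `x` in `j` steps, each of which multiplies by `x`, for the `n × n`
Cayley table `a`. -/
def orbit (n : ℕ) (a : ℕ → ℕ) (x j : ℕ) : ℕ := (fun y => a (x * n + y))^[j] x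

/-- Write the adjacency matrix of the power graph into array `3`, for the Cayley table in
array `0`. -/
def powerAdjacency : Prog :=
  loopUp 41 0 (seq (copy 42 41) (loopUp 43 0 (seq (seq (copy 22 41) (copy 23 42)) (seq mulAdd
    (seq (seq (const 98 1) (seq (store 3 20 98) (seq (load 44 0 20)
      (seq (copy 22 42) (copy 23 41))))) (seq mulAdd
        (seq (const 98 1) (seq (store 3 20 98) (copy 42 44)))))))))

/-- Each pair of `x` and a power of `x` is marked in both orders. Diagonal entries are marked too,
which is harmless because `Touch` includes equality. -/
theorem powerAdjacency_ends {s : State} {n W : ℕ} (hW : 32 ≤ W) (e0 : s.reg 0 = n) (h : n ≤ W)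
    (htab : ∀ i < n, ∀ j < n, s.mem 0 (i * n + j) < n) (h3 : ∀ i, s.mem 3 i = 0) :
    powerAdjacency.Ends s (W ^ 14) fun s' => ∀ i, 0 < s'.mem 3 i ↔ ∃ x < n, ∃ j < n,
      i = x * n + orbit n (s.mem 0) x j ∨ i = orbit n (s.mem 0) x j * n + x := by
  refine Ends.loopUp_pow 12 (fun d s' => ∀ i, 0 < s'.mem 3 i ↔ ∃ x < d, ∃ j < n,
      i = x * n + orbit n (s.mem 0) x j ∨ i = orbit n (s.mem 0) x j * n + x) rfl e0 h hW
      (by simp [h3]) fun x hx s₁ f₁ ex hI => ?_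
  -- Needed for the time of `mulAdd`, which is governed by its first factor.
  have horb : ∀ j, orbit n (s.mem 0) x j < n := by
    intro j
    induction j with
    | zero => exact hx
    | succ j ih => rw [orbit, Function.iterate_succ_apply']; exact htab x hx _ ih
  refine Ends.seq_pow hW (ends_eval_pow 10 hW rfl (by decide)) fun s₂ f₂ h₂ =>
    (Ends.loopUp_pow 9 (fun d s' => s'.reg 42 = orbit n (s.mem 0) x d ∧
      ∀ i, 0 < s'.mem 3 i ↔ (∃ y < x, ∃ j < n,
      i = y * n + orbit n (s.mem 0) y j ∨ i = orbit n (s.mem 0) y j * n + y) ∨ ∃ j < d,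
      i = x * n + orbit n (s.mem 0) x j ∨ i = orbit n (s.mem 0) x j * n + x) rfl
      (by rw [f₂.1 0 rfl, f₁.1 0 rfl, e0]) h hW ?_ fun j hj s₃ f₃ ej hJ => ?_).imp fun s₃ f₃ h₃ => ?_
  · simp [h₂, eval, copy, ex, hI, orbit]
  · obtain ⟨i42, hJ⟩ := hJ
    refine Ends.seq_pow hW (ends_eval_pow 7 hW rfl (by decide)) fun s₄ f₄ h₄ => ?_
    have e22 : s₄.reg 22 = x := by
      rw [h₄]; simp [eval, copy, f₃.1 41 rfl, f₂.1 41 rfl, ex]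
    have e23 : s₄.reg 23 = orbit n (s.mem 0) x j := by rw [h₄]; simp [eval, copy, i42]
    refine Ends.seq_pow hW ((mulAdd_ends hW (by rw [e22]; omega)).pow_mono hW (by omega))
      fun s₅ f₅ h₅ => ?_
    rw [e22, e23, f₄.1 0 rfl, f₃.1 0 rfl, f₂.1 0 rfl, f₁.1 0 rfl, e0] at h₅
    refine Ends.seq_pow hW (ends_eval_pow 5 hW rfl (by decide)) fun s₆ f₆ h₆ => ?_
    have e22' : s₆.reg 22 = orbit n (s.mem 0) x j := by
      rw [h₆]; simp [eval, copy, f₅.1 42 rfl, f₄.1 42 rfl, i42]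
    have e23' : s₆.reg 23 = x := by
      rw [h₆]; simp [eval, copy, f₅.1 41 rfl, f₄.1 41 rfl, f₃.1 41 rfl, f₂.1 41 rfl, ex]
    have e44 : s₆.reg 44 = orbit n (s.mem 0) x (j + 1) := by
      rw [h₆, orbit, Function.iterate_succ_apply']
      simp [eval, copy, h₅, f₅.2 0 rfl, f₄.2 0 rfl, f₃.2 0 rfl, f₂.2 0 rfl, f₁.2 0 rfl, orbit]
    refine Ends.seq_pow hW (mulAdd_ends hW (by rw [e22']; exact (horb j).le.trans h))
      fun s₇ f₇ h₇ => Ends.of_eval_pow 4 hW rfl (by decide) ?_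
    rw [e22', e23', f₆.1 0 rfl, f₅.1 0 rfl, f₄.1 0 rfl, f₃.1 0 rfl, f₂.1 0 rfl, f₁.1 0 rfl,
      e0] at h₇
    refine ⟨by simp [eval, copy, f₇.1 44 rfl, e44], fun i => ?_⟩
    have hJi := hJ i
    rw [← f₄.2 3 rfl, ← f₅.2 3 rfl] at hJi
    have hsplit : ∀ P : ℕ → Prop, (∃ i < j + 1, P i) ↔ (∃ i < j, P i) ∨ P j := fun P => by
      simp only [Nat.lt_succ_iff_lt_or_eq, or_and_right, exists_or, exists_eq_left]
    rw [hsplit, ← or_assoc, ← hJi]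
    simp only [eval, copy, State.mem_setReg, State.mem_setMem, if_true, State.reg_setReg, h₇,
      f₇.2 3 rfl, h₆, h₅, Nat.reduceEqDiff, if_false]
    split_ifs <;> simp_all
  · intro i
    have hsplit : ∀ P : ℕ → Prop, (∃ i < x + 1, P i) ↔ (∃ i < x, P i) ∨ P x := fun P => by
      simp only [Nat.lt_succ_iff_lt_or_eq, or_and_right, exists_or, exists_eq_left]
    rw [hsplit]
    exact h₃.2 i

end Prog

/-! ### Multisets of colours -/

/-- On representing lists this is the fact that a sublist of a mapped list is the image of a
sublist. -/
theorem _root_.Multiset.exists_le_map_eq {α β : Type*} {f : α → β} {s : Multiset α}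
    {t : Multiset β} (h : t ≤ s.map f) : ∃ u ≤ s, u.map f = t := by
  induction s using Quotient.inductionOn with | _ l
  induction t using Quotient.inductionOn with | _ m
  obtain ⟨m', hm, hs⟩ := h
  obtain ⟨l', hl, rfl⟩ := List.sublist_map_iff.1 hs
  exact ⟨l', hl.subperm, Quotient.sound hm⟩

/-- The colours still missing after `A` form a submultiset of the colours of `B \ A`; lift it to a
subset of `B \ A` and add that to `A`. -/
theorem exists_finset_between {α C : Type*} [DecidableEq α] {f : α → C} {A B : Finset α}
    {M : Multiset C} (hAB : A ⊆ B) (hA : A.val.map f ≤ M) (hB : M ≤ B.val.map f) :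
    ∃ S : Finset α, A ⊆ S ∧ S ⊆ B ∧ S.val.map f = M := by
  obtain ⟨T, rfl⟩ := Multiset.le_iff_exists_add.1 hA
  have hsplit : B.val = A.val + (B \ A).val := by
    rw [Finset.sdiff_val, add_tsub_cancel_of_le (Finset.val_le_iff.2 hAB)]
  rw [hsplit, Multiset.map_add] at hB
  obtain ⟨u, hu, rfl⟩ := Multiset.exists_le_map_eq (le_of_add_le_add_left hB)
  let U : Finset α := ⟨u, Multiset.nodup_of_le hu (B \ A).nodup⟩
  have hU : U ⊆ B \ A := Finset.val_le_iff.1 hu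
  have hd : Disjoint A U := Finset.disjoint_of_subset_right hU Finset.disjoint_sdiff
  refine ⟨A.disjUnion U hd, ?_, ?_, ?_⟩
  · intro x hx; simp [hx]
  · intro x hx
    rcases Finset.mem_disjUnion.1 hx with hx | hx
    · exact hAB hx
    · exact (Finset.mem_sdiff.1 (hU hx)).1
  · simp [Finset.disjUnion, U]

theorem colorCount_eq_count {n : ℕ} (col : Fin n → ℕ) {c g : ℕ → ℕ} (S : Finset (Fin n))
    (hc : ∀ v : Fin n, c v = col v) (hg : ∀ v : Fin n, g v = ind (v ∈ S)) (x : ℕ) :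
    colorCount n c g x = (S.val.map col).count x := by
  rw [colorCount, Finset.sum_range, Multiset.count_map, ← Finset.filter_val, Finset.card_val,
    Finset.card_filter, ← Finset.sum_filter_add_sum_filter_not Finset.univ (· ∈ S)]
  rw [Finset.sum_eq_zero (s := Finset.univ.filter (· ∉ S)), add_zero]
  · refine Finset.sum_congr (by ext; simp) fun v hv => ?_
    rw [hc, hg, ind_of (by simpa using hv)]
    simp only [eq_comm]
  · intro v hv
    rw [hg, ind_of_not (by simpa using hv)]
    simp

theorem colorCount_motif (motif : List ℕ) {μ : ℕ → ℕ}
    (hμ : ∀ j < motif.length, μ j = motif.getD j 0) (x : ℕ) :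
    colorCount motif.length μ (fun _ => 1) x = (motif : Multiset ℕ).count x := by
  rw [colorCount_eq_count motif.get Finset.univ (fun v => by
    rw [hμ v v.2, List.getD_eq_getElem _ _ v.2]; rfl) (fun v => by simp [ind])]
  rw [Fin.univ_val_map, List.ofFn_get]

/-! ### Connected sets of vertices -/

variable {V : Type*} {Γ : SimpleGraph V}

/-- Each of the first `k` vertices of the sequence but the first is equal or adjacent to an earlier
one. -/
def IsChain (Γ : SimpleGraph V) (R : ℕ → V) (k : ℕ) : Prop :=
  ∀ j < k, 0 < j → ∃ i < j, R i = R j ∨ Γ.Adj (R i) (R j)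

/-- By strong induction every vertex of the sequence is reachable from `R 0` through earlier ones,
and every other vertex of `S` is one edge away from the sequence. -/
theorem connected_of_isChain {R : ℕ → V} {k : ℕ} (hk : 0 < k) (hR : IsChain Γ R k)
    {S : Set V} (hmem : ∀ i < k, R i ∈ S)
    (hdom : ∀ v ∈ S, ∃ i < k, R i = v ∨ Γ.Adj (R i) v) : (Γ.induce S).Connected := by
  have step : ∀ (u v : S), (u : V) = v ∨ Γ.Adj u v → (Γ.induce S).Reachable u v := by
    rintro u v (h | h)
    · rw [Subtype.ext h]
    · exact SimpleGraph.Adj.reachable (G := Γ.induce S) h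
  have hchain : ∀ j (hj : j < k),
      (Γ.induce S).Reachable ⟨R 0, hmem 0 hk⟩ ⟨R j, hmem j hj⟩ := by
    intro j
    induction j using Nat.strong_induction_on with
    | _ j ih =>
      intro hj
      rcases Nat.eq_zero_or_pos j with rfl | h0
      · exact SimpleGraph.Reachable.refl _
      · obtain ⟨i, hi, h⟩ := hR j hj h0
        exact (ih i hi (hi.trans hj)).trans (step ⟨R i, hmem i (hi.trans hj)⟩ ⟨R j, hmem j hj⟩ h)
  rw [SimpleGraph.connected_iff_exists_forall_reachable]
  refine ⟨⟨R 0, hmem 0 hk⟩, fun v => ?_⟩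
  obtain ⟨i, hi, h⟩ := hdom v v.2
  exact (hchain i hi).trans (step ⟨R i, hmem i hi⟩ v h)

/-- The vertices are partitioned into at most `k` cliques of vertices of the same type. -/
def HasCliqueTypes (Γ : SimpleGraph V) (k : ℕ) : Prop :=
  ∃ part : V → Fin k, ∀ u v, part u = part v → SameType Γ u v ∧ (u ≠ v → Γ.Adj u v)

/-- Greedy construction: while some class met by `S` is missed, one more class can be hit without
breaking the chain. The first alternative says that all entries so far lie in distinct classes, the
second that nothing is missed. -/
theorem exists_isChain_hitting {S : Set V} (hS : (Γ.induce S).Connected) {k : ℕ}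
    {part : V → Fin k} (hpart : ∀ u v, part u = part v → SameType Γ u v) (j : ℕ) :
    ∃ R : ℕ → V, (∀ i < j + 1, R i ∈ S) ∧ IsChain Γ R (j + 1) ∧
      (j + 1 ≤ ((Finset.range (j + 1)).image (part ∘ R)).card ∨
        ∀ v ∈ S, ∃ i < j + 1, part (R i) = part v) := by
  induction j with
  | zero =>
    obtain ⟨v⟩ := hS.nonempty
    exact ⟨fun _ => v, fun _ _ => v.2, fun j hj h0 => by omega, Or.inl (by simp)⟩
  | succ j ih =>
    obtain ⟨R, hRS, hR, hcard⟩ := ih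
    have extend : ∀ w ∈ S, (∃ i < j + 1, R i = w ∨ Γ.Adj (R i) w) →
        (∀ i < j + 1 + 1, Function.update R (j + 1) w i ∈ S) ∧
          IsChain Γ (Function.update R (j + 1) w) (j + 1 + 1) := by
      rintro w hw ⟨i₀, hi₀, hadj⟩
      constructor
      · intro i hi
        by_cases h : i = j + 1
        · subst h; simpa
        · rw [Function.update_of_ne h]; exact hRS i (by omega)
      · intro i hi h0
        by_cases h : i = j + 1
        · subst h
          refine ⟨i₀, hi₀, ?_⟩
          rwa [Function.update_self, Function.update_of_ne (by omega)]
        · obtain ⟨l, hl, h'⟩ := hR i (by omega) h0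
          refine ⟨l, hl, ?_⟩
          rwa [Function.update_of_ne h, Function.update_of_ne (by omega)]
    by_cases hall : ∀ v ∈ S, ∃ i < j + 1, part (R i) = part v
    · obtain ⟨h1, h2⟩ := extend (R 0) (hRS 0 (by omega)) ⟨0, by omega, Or.inl rfl⟩
      refine ⟨_, h1, h2, Or.inr fun v hv => ?_⟩
      obtain ⟨i, hi, h⟩ := hall v hv
      exact ⟨i, by omega, by rwa [Function.update_of_ne (by omega)]⟩
    · have hcard := hcard.resolve_right hall
      push Not at hall
      obtain ⟨v, hv, hne⟩ := hall
      obtain ⟨p⟩ := hS.preconnected ⟨R 0, hRS 0 (by omega)⟩ ⟨v, hv⟩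
      -- A walk inside `S` from `R 0` to a vertex of a missed class has an edge leaving the union of
      -- the classes already hit.
      obtain ⟨d, -, ⟨i, hi, hd⟩, hd'⟩ := p.exists_boundary_dart
        {x | ∃ i < j + 1, part (R i) = part x} ⟨0, by omega, rfl⟩
        fun ⟨i, hi, h⟩ => hne i hi h
      have hadj : Γ.Adj d.fst d.snd := d.adj
      have hnew : ∀ i < j + 1, part (R i) ≠ part d.snd := fun i hi h => hd' ⟨i, hi, h⟩
      -- The tail of that edge need not be in the sequence, but it has the type of some `R i`, so `R
      -- i` is adjacent to the head as well.
      have hadj' : Γ.Adj (R i) d.snd := by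
        have hmem : (d.snd : V) ∈ Γ.neighborSet d.fst \ {R i} :=
          ⟨hadj, fun h => hnew i hi (by rw [h])⟩
        have hst : Γ.neighborSet (R i) \ {(d.fst : V)} = Γ.neighborSet d.fst \ {R i} :=
          hpart _ _ hd
        exact (hst ▸ hmem).1
      obtain ⟨h1, h2⟩ := extend d.snd d.snd.2 ⟨i, hi, Or.inr hadj'⟩
      refine ⟨_, h1, h2, Or.inl ?_⟩
      have himg : (Finset.range (j + 1)).image (part ∘ Function.update R (j + 1) d.snd) =
          (Finset.range (j + 1)).image (part ∘ R) := by
        refine Finset.image_congr fun l hl => ?_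
        have : l < j + 1 := by simpa using hl
        simp [Function.update_of_ne (show l ≠ j + 1 by omega)]
      rw [Finset.range_add_one, Finset.image_insert, himg, Finset.card_insert_of_notMem]
      · omega
      · simp only [Finset.mem_image, Finset.mem_range, Function.comp, Function.update_self]
        rintro ⟨l, hl, h⟩
        exact hnew l hl h

/-- Either `k` distinct classes are hit, hence all of them, or all classes met by `S` are. Since a
class is a clique, hitting it dominates it. -/
theorem exists_isChain_dominating {k : ℕ} (hΓ : HasCliqueTypes Γ k) {S : Set V}
    (hS : (Γ.induce S).Connected) :
    ∃ R : ℕ → V, (∀ i < k, R i ∈ S) ∧ IsChain Γ R k ∧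
      ∀ v ∈ S, ∃ i < k, R i = v ∨ Γ.Adj (R i) v := by
  obtain ⟨part, hpart⟩ := hΓ
  obtain ⟨v₀⟩ := hS.nonempty
  obtain ⟨j, rfl⟩ : ∃ j, k = j + 1 := ⟨k - 1, by have := (part v₀).pos; omega⟩
  obtain ⟨R, hRS, hR, h⟩ := exists_isChain_hitting hS (fun u v h => (hpart u v h).1) j
  refine ⟨R, hRS, hR, fun v hv => ?_⟩
  have hhit : ∃ i < j + 1, part (R i) = part v := by
    refine h.elim (fun hc => ?_) fun h => h v hv
    have huniv : (Finset.range (j + 1)).image (part ∘ R) = Finset.univ :=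
      Finset.eq_univ_of_card _ (le_antisymm (Finset.card_le_univ _) (by simpa using hc))
    have := huniv ▸ Finset.mem_univ (part v)
    simpa using this
  obtain ⟨i, hi, h⟩ := hhit
  exact ⟨i, hi, or_iff_not_imp_left.2 (hpart _ _ h).2⟩

/-! ### Correctness of the algorithm -/

theorem exists_digit_eq {n : ℕ} (k : ℕ) (R : ℕ → Fin n) :
    ∃ N < n ^ k, ∀ i < k, digit n N i = R i := by
  induction k generalizing R with
  | zero => exact ⟨0, by simp, by simp⟩
  | succ k ih =>
    obtain ⟨N, hN, h⟩ := ih fun i => R (i + 1)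
    have hn : 0 < n := (R 0).pos
    refine ⟨R 0 + n * N, ?_, ?_⟩
    · calc (R 0 : ℕ) + n * N < n + n * N := by have := (R 0).2; omega
        _ = n * (N + 1) := by ring
        _ ≤ n * n ^ k := by gcongr; omega
        _ = n ^ (k + 1) := by ring
    · rintro (_ | i) hi
      · simp [digit, Nat.mod_eq_of_lt (R 0).2]
      · have hd : ((R 0 : ℕ) + n * N) / n = N := by
          rw [Nat.add_mul_div_left _ _ hn, Nat.div_eq_of_lt (R 0).2, zero_add]
        rw [digit, pow_succ', ← Nat.div_div_eq_div_mul, hd]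
        exact h i (by omega)

open Classical in
theorem accepts_iff {n k : ℕ} {Γ : SimpleGraph (Fin n)} {col : Fin n → ℕ} {motif : List ℕ}
    {c μ a : ℕ → ℕ} (hc : ∀ v : Fin n, c v = col v)
    (hμ : ∀ j < motif.length, μ j = motif.getD j 0)
    (ha : ∀ u v : Fin n, Touch n a u v ↔ u = v ∨ Γ.Adj u v) {r : ℕ → ℕ} (R : ℕ → Fin n)
    (hr : ∀ i < k, r i = R i) :
    Accepts n motif.length k c μ a r ↔ IsChain Γ R k ∧
      (Finset.univ.filter fun v => ∃ i < k, R i = v).val.map col ≤ motif ∧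
      (motif : Multiset ℕ) ≤
        (Finset.univ.filter fun v => ∃ i < k, R i = v ∨ Γ.Adj (R i) v).val.map col := by
  set A := Finset.univ.filter fun v => ∃ i < k, R i = v with hA
  set B := Finset.univ.filter fun v => ∃ i < k, R i = v ∨ Γ.Adj (R i) v with hB
  have hfit : ∀ x, ColorFits n motif.length c μ (fun v => ind (∃ i < k, r i = v))
      (fun v => ind (∃ i < k, Touch n a (r i) v)) x ↔
      (A.val.map col).count x ≤ (motif : Multiset ℕ).count x ∧
        (motif : Multiset ℕ).count x ≤ (B.val.map col).count x := by
    intro x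
    rw [ColorFits, colorCount_motif motif hμ, colorCount_eq_count col A hc,
      colorCount_eq_count col B hc]
    · intro v
      congr 1
      simp only [hB, Finset.mem_filter, Finset.mem_univ, true_and, eq_iff_iff]
      exact exists_congr fun i => and_congr_right fun hi => by rw [hr i hi, ha]
    · intro v
      congr 1
      simp only [hA, Finset.mem_filter, Finset.mem_univ, true_and, eq_iff_iff]
      exact exists_congr fun i => and_congr_right fun hi => by rw [hr i hi, Fin.ext_iff]
  simp only [Accepts, hfit]
  refine and_congr ?_ ?_
  · refine forall_congr' fun j => forall_congr' fun hj => imp_congr_right fun _ =>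
      exists_congr fun i => and_congr_right fun hi => ?_
    rw [hr i (hi.trans hj), hr j hj, ha]
  · rw [Multiset.le_iff_count, Multiset.le_iff_count, ← forall_and (p := fun a => _ ≤ _)]
    refine ⟨fun ⟨h1, h2⟩ x => ?_, fun h => ⟨fun v _ => h _, fun j _ => h _⟩⟩
    -- The test covers colours of vertices and of the motif; for any remaining colour all three
    -- counts vanish.
    by_cases hx : ∃ v, col v = x
    · obtain ⟨v, rfl⟩ := hx
      rw [← hc]
      exact h1 v v.2
    · by_cases hx' : x ∈ motif
      · obtain ⟨j, hj, rfl⟩ := List.getElem_of_mem hx'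
        have := h2 j hj
        rwa [hμ j hj, List.getD_eq_getElem _ _ hj] at this
      · have e : ∀ S : Finset (Fin n), (S.val.map col).count x = 0 := fun S =>
          Multiset.count_eq_zero.2 fun h => hx (by
            obtain ⟨v, -, hv⟩ := Multiset.mem_map.1 h
            exact ⟨v, hv⟩)
        have e' : (motif : Multiset ℕ).count x = 0 := Multiset.count_eq_zero.2 (by simpa using hx')
        simp [e, e']

theorem exists_accepts_iff {n k : ℕ} (hn : 0 < n) {Γ : SimpleGraph (Fin n)}
    (hΓ : HasCliqueTypes Γ k) {col : Fin n → ℕ} {motif : List ℕ}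
    {c μ a : ℕ → ℕ} (hc : ∀ v : Fin n, c v = col v)
    (hμ : ∀ j < motif.length, μ j = motif.getD j 0)
    (ha : ∀ u v : Fin n, Touch n a u v ↔ u = v ∨ Γ.Adj u v) :
    (motif.length ≤ n ∧ ∃ N < n ^ k, Accepts n motif.length k c μ a (digit n N)) ↔
      MotifOccurs Γ col (motif : Multiset ℕ) := by
  classical
  constructor
  · rintro ⟨-, N, -, hN⟩
    have hk : 0 < k := by
      obtain ⟨part, -⟩ := hΓ
      exact (part ⟨0, hn⟩).pos
    let R : ℕ → Fin n := fun i => ⟨digit n N i, Nat.mod_lt _ hn⟩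
    obtain ⟨hR, hA, hB⟩ := (accepts_iff hc hμ ha R fun i _ => rfl).1 hN
    obtain ⟨S, hAS, hSB, hS⟩ := exists_finset_between (fun v hv => by
      simp only [Finset.mem_filter, Finset.mem_univ, true_and] at hv ⊢
      exact hv.imp fun i hi => ⟨hi.1, Or.inl hi.2⟩) hA hB
    refine ⟨S, connected_of_isChain hk hR (fun i hi => hAS (by
      simp only [Finset.mem_filter, Finset.mem_univ, true_and]; exact ⟨i, hi, rfl⟩))
      fun v hv => by simpa using hSB hv, hS⟩
  · rintro ⟨S, hconn, hS⟩
    refine ⟨?_, ?_⟩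
    · have := congrArg Multiset.card hS
      simp only [Multiset.card_map, Multiset.coe_card] at this
      rw [← this]
      simpa using Finset.card_le_univ S
    · obtain ⟨R, hRS, hR, hdom⟩ := exists_isChain_dominating hΓ hconn
      obtain ⟨N, hN, hd⟩ := exists_digit_eq k R
      refine ⟨N, hN, (accepts_iff hc hμ ha R hd).2 ⟨hR, ?_, ?_⟩⟩
      · rw [← hS]
        refine Multiset.map_le_map (Finset.val_le_iff.2 fun v hv => ?_)
        simp only [Finset.mem_filter, Finset.mem_univ, true_and] at hv
        obtain ⟨i, hi, rfl⟩ := hv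
        exact hRS i hi
      · rw [← hS]
        refine Multiset.map_le_map (Finset.val_le_iff.2 fun v hv => ?_)
        simpa using hdom v hv

/-! ### Power graphs of cyclic groups -/

theorem powerGraph_adj {G : Type*} [Group G] [Finite G] {x y : G} :
    (powerGraph G).Adj x y ↔
      x ≠ y ∧ (y ∈ Subgroup.zpowers x ∨ x ∈ Subgroup.zpowers y) := by
  have h : ∀ x y : G, (∃ m : ℕ, 0 < m ∧ y = x ^ m) ↔ y ∈ Subgroup.zpowers x := by
    intro x y
    constructor
    · rintro ⟨m, -, rfl⟩
      exact Subgroup.pow_mem _ (Subgroup.mem_zpowers x) m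
    · intro hy
      obtain ⟨m, rfl⟩ := mem_powers_iff_mem_zpowers.2 hy
      -- Adding the order makes the exponent positive without changing the power.
      exact ⟨m + orderOf x, by have := orderOf_pos x; omega, by simp [pow_add, pow_orderOf_eq_one]⟩
  simp [powerGraph, SimpleGraph.fromRel_adj, h]

/-- In a cyclic group `a ^ m = 1` has at most `m` solutions. For `m = orderOf x` the powers of `x`
already supply that many, so `y` is among them. -/
theorem zpowers_le_of_orderOf_eq {G : Type*} [Group G] [Finite G] [IsCyclic G] {x y : G}
    (h : orderOf x = orderOf y) : Subgroup.zpowers y ≤ Subgroup.zpowers x := by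
  classical
  have := Fintype.ofFinite G
  rw [Subgroup.zpowers_le]
  have hsub : Finset.univ.filter (· ∈ Subgroup.zpowers x) ⊆
      Finset.univ.filter fun a : G => a ^ orderOf x = 1 := by
    intro a ha
    simp only [Finset.mem_filter, Finset.mem_univ, true_and] at ha ⊢
    exact orderOf_dvd_iff_pow_eq_one.1 (orderOf_dvd_of_mem_zpowers ha)
  have heq := Finset.eq_of_subset_of_card_le hsub (by
    refine (IsCyclic.card_pow_eq_one_le (orderOf_pos x)).trans_eq ?_
    rw [← Nat.card_zpowers, ← Fintype.card_subtype, Nat.card_eq_fintype_card])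
  have hy : y ∈ Finset.univ.filter fun a : G => a ^ orderOf x = 1 := by
    simp [h, pow_orderOf_eq_one]
  rw [← heq] at hy
  simpa using hy

/-- The partition is by order. Equal orders give equal generated subgroups, hence equal adjacencies
and mutual adjacency. -/
theorem hasCliqueTypes_powerGraph {G : Type*} [Group G] [Finite G] [IsCyclic G] :
    HasCliqueTypes (powerGraph G) (Nat.card G).divisors.card := by
  refine ⟨fun x => (Nat.card G).divisors.equivFin
    ⟨orderOf x, Nat.mem_divisors.2 ⟨orderOf_dvd_natCard x, Nat.card_pos.ne'⟩⟩, fun u v h => ?_⟩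
  have ho : orderOf u = orderOf v := by simpa using h
  have hz : Subgroup.zpowers u = Subgroup.zpowers v :=
    le_antisymm (zpowers_le_of_orderOf_eq ho.symm) (zpowers_le_of_orderOf_eq ho)
  have hz' : ∀ z, u ∈ Subgroup.zpowers z ↔ v ∈ Subgroup.zpowers z := fun z => by
    rw [← Subgroup.zpowers_le, hz, Subgroup.zpowers_le]
  constructor
  · ext z
    simp only [Set.mem_sdiff, SimpleGraph.mem_neighborSet, powerGraph_adj, Set.mem_singleton_iff,
      hz, hz', ne_eq, @eq_comm _ z]
    tauto
  · intro hne
    exact powerGraph_adj.2 ⟨hne, Or.inl (hz ▸ Subgroup.mem_zpowers v)⟩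

theorem HasCliqueTypes.of_iso {V' : Type*} {Γ' : SimpleGraph V'} {k : ℕ}
    (h : HasCliqueTypes Γ' k) (f : Γ ≃g Γ') : HasCliqueTypes Γ k := by
  obtain ⟨part, hpart⟩ := h
  refine ⟨part ∘ f, fun u v huv => ?_⟩
  obtain ⟨h1, h2⟩ := hpart _ _ huv
  constructor
  · ext z
    have := Set.ext_iff.1 h1 (f z)
    simpa [SimpleGraph.Iso.map_adj_iff] using this
  · intro hne
    exact f.map_adj_iff.1 (h2 fun h => hne (f.injective h))

theorem hasCliqueTypes_Zn {n : ℕ} (hn : 0 < n) :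
    HasCliqueTypes (powerGraph (Zn n)) n.divisors.card := by
  have : NeZero n := ⟨hn.ne'⟩
  have : Finite (Zn n) := inferInstanceAs (Finite (ZMod n))
  have h := hasCliqueTypes_powerGraph (G := Zn n)
  rwa [show Nat.card (Zn n) = n from Nat.card_zmod n] at h

/-! ### The two programs -/

theorem decidesWithin_of_ends {p : Prog} {s : State} {Q Q' : Prop} {T : ℕ}
    (h : p.Ends s T fun s' => s'.reg 0 = ind Q') (hQ : Q' ↔ Q) : DecidesWithin p s Q T := by
  obtain ⟨s', t, hr, ht, h⟩ := h
  refine ⟨s', t, hr, ht, ?_⟩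
  by_cases hq : Q
  · exact Or.inl ⟨hq, h.trans (ind_of (hQ.2 hq))⟩
  · exact Or.inr ⟨hq, h.trans (ind_of_not fun h' => hq (hQ.1 h'))⟩

theorem input_table {n : ℕ} (table : Fin n → Fin n → ℕ) (col : Fin n → ℕ) (motif : List ℕ)
    (u v : Fin n) : (input n table col motif).mem 0 (u * n + v) = table u v := by
  have h : (u * n + v : ℕ) < n * n := by
    calc (u * n + v : ℕ) < u * n + n := by have := v.2; omega
      _ = (u + 1) * n := by ring
      _ ≤ n * n := by gcongr; have := u.2; omega
  have h1 : Fin.divNat ⟨(u * n + v : ℕ), h⟩ = u := by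
    ext
    simp [Fin.divNat, Nat.mul_comm _ n, Nat.mul_add_div u.pos, Nat.div_eq_of_lt v.2]
  have h2 : Fin.modNat ⟨(u * n + v : ℕ), h⟩ = v := by
    ext
    simp [Fin.modNat, Nat.mod_eq_of_lt v.2]
  simp only [input, if_true, dif_pos h, h1, h2]

/-- A common bound for the running times. -/
def runTime (n : ℕ) : ℕ := (n + 32) ^ (n.divisors.card * 26)

/-- Here `W = (n + 32) ^ k` with `k` the number of divisors: it exceeds `32` even for small `n` and
bounds the `n ^ k` candidates. The search needs `W ^ 25`; the 26th factor is used when a Cayley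
table has to be converted. -/
theorem solvesFromGraph : SolvesFromGraph (Prog.solve 0) runTime := by
  intro n hn Γ ⟨f⟩ col motif
  have hd : n.divisors.card ≠ 0 := by simp [hn.ne']
  have hW : 32 ≤ (n + 32) ^ n.divisors.card := le_trans (by omega) (Nat.le_self_pow hd (n + 32))
  refine decidesWithin_of_ends (((Prog.solve_ends (by omega) (by omega) hn rfl rfl hW
    (Nat.pow_le_pow_left (by omega) _)).pow_mono hW (by omega : 25 ≤ 26)).mono
    (by rw [runTime, pow_mul])) ?_
  refine exists_accepts_iff hn ((hasCliqueTypes_Zn hn).of_iso f) (fun v => by simp [input])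
    (fun j _ => by simp [input]) fun u v => ?_
  rw [Touch, input_table, adjTable, Fin.ext_iff]
  split_ifs with h <;> simp [h]

theorem orbit_input {n : ℕ} {G : Type*} [Group G] (e : Fin n ≃ G) (col : Fin n → ℕ)
    (motif : List ℕ) (u : Fin n) (j : ℕ) :
    Prog.orbit n ((input n (cayleyTable e) col motif).mem 0) u j = e.symm (e u ^ (j + 1)) := by
  induction j with
  | zero => simp [Prog.orbit]
  | succ j ih =>
    rw [Prog.orbit, Function.iterate_succ_apply', ← Prog.orbit, ih, input_table, cayleyTable,
      Equiv.apply_symm_apply, ← pow_succ']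

/-- Exponents matter only modulo the group order, so `n` steps along each orbit find all positive
powers. -/
theorem exists_pow_lt_card {G : Type*} [Group G] [Finite G] {x y : G} :
    (∃ m : ℕ, 0 < m ∧ y = x ^ m) ↔ ∃ j < Nat.card G, y = x ^ (j + 1) := by
  constructor
  · rintro ⟨m, hm, rfl⟩
    refine ⟨(m - 1) % Nat.card G, Nat.mod_lt _ Nat.card_pos, ?_⟩
    rw [pow_succ, pow_mod_natCard, ← pow_succ, Nat.sub_add_cancel hm]
  · rintro ⟨j, -, rfl⟩
    exact ⟨j + 1, by omega, rfl⟩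

theorem solvesFromGroup :
    SolvesFromGroup (Prog.seq Prog.powerAdjacency (Prog.solve 3)) runTime := by
  intro n hn e col motif
  have : NeZero n := ⟨hn.ne'⟩
  have : Finite (Zn n) := inferInstanceAs (Finite (ZMod n))
  have hcard : Nat.card (Zn n) = n := Nat.card_zmod n
  have hd : n.divisors.card ≠ 0 := by simp [hn.ne']
  have hle : n + 32 ≤ (n + 32) ^ n.divisors.card := Nat.le_self_pow hd (n + 32)
  have hW : 32 ≤ (n + 32) ^ n.divisors.card := le_trans (by omega) hle
  set s := input n (cayleyTable e) col motif with hs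
  have key : (Prog.seq Prog.powerAdjacency (Prog.solve 3)).Ends s (runTime n) fun s' =>
      s'.reg 0 = ind (MotifOccurs ((powerGraph (Zn n)).comap e) col (motif : Multiset ℕ)) := by
    refine ((Prog.powerAdjacency_ends (n := n) hW rfl (by omega) (fun i hi j hj => ?_)
      fun i => by simp [hs, input]).pow_mono hW (by omega)).seq_pow (a := 25) hW
      (fun s₁ f₁ h₁ => (Prog.solve_ends (n := n) (m := motif.length) (by omega) (by omega) hn
        (f₁.1 0 rfl) (f₁.1 1 rfl) hW (Nat.pow_le_pow_left (by omega) _)).imp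
          fun s₂ _ h₂ => h₂.trans (congrArg ind (propext ?_))) |>.mono (by rw [runTime, pow_mul])
    · rw [hs, input_table _ _ _ ⟨i, hi⟩ ⟨j, hj⟩, cayleyTable]
      exact Fin.is_lt _
    · rw [f₁.2 1 rfl, f₁.2 2 rfl]
      refine exists_accepts_iff hn ((hasCliqueTypes_Zn hn).of_iso
        (SimpleGraph.Iso.comap e (powerGraph (Zn n)))) (fun v => by simp [hs, input])
        (fun j _ => by simp [hs, input]) fun u v => ?_
      have hpair : ∀ x y x' y' : ℕ, y < n → y' < n →
          (x * n + y = x' * n + y' ↔ x = x' ∧ y = y') := by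
        intro x y x' y' hy hy'
        refine ⟨fun h => ?_, fun h => by rw [h.1, h.2]⟩
        have h1 := congrArg (· / n) h
        have h2 := congrArg (· % n) h
        simp only [Nat.mul_comm _ n, Nat.mul_add_div hn, Nat.div_eq_of_lt hy,
          Nat.div_eq_of_lt hy', Nat.mul_add_mod, Nat.mod_eq_of_lt hy, Nat.mod_eq_of_lt hy'] at h1 h2
        exact ⟨h1, h2⟩
      have horb : ∀ (x : Fin n) j, Prog.orbit n (s.mem 0) x j = e.symm (e x ^ (j + 1)) :=
        fun x j => orbit_input e col motif x j
      have hedge : 0 < s₁.mem 3 (u * n + v) ↔ (∃ j < n, e v = e u ^ (j + 1)) ∨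
          ∃ j < n, e u = e v ^ (j + 1) := by
        rw [h₁]
        constructor
        · rintro ⟨x, hx, j, hj, h⟩
          have hx' := horb ⟨x, hx⟩ j
          simp only at hx'
          rw [hx', hpair _ _ _ _ v.2 (Fin.is_lt _), hpair _ _ _ _ v.2 hx] at h
          rcases h with ⟨hu, hv⟩ | ⟨hu, hv⟩
          · left
            refine ⟨j, hj, ?_⟩
            have hu' : u = ⟨x, hx⟩ := Fin.ext hu
            rw [Fin.ext hv, Equiv.apply_symm_apply, hu']
          · right
            refine ⟨j, hj, ?_⟩
            have hv' : v = ⟨x, hx⟩ := Fin.ext hv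
            rw [Fin.ext hu, Equiv.apply_symm_apply, hv']
        · rintro (⟨j, hj, h⟩ | ⟨j, hj, h⟩)
          · exact ⟨u, u.2, j, hj, Or.inl (by rw [horb, ← h, Equiv.symm_apply_apply])⟩
          · exact ⟨v, v.2, j, hj, Or.inr (by rw [horb, ← h, Equiv.symm_apply_apply])⟩
      rw [Touch, hedge, SimpleGraph.comap_adj, powerGraph, SimpleGraph.fromRel_adj,
        exists_pow_lt_card, exists_pow_lt_card, hcard, ← Fin.ext_iff, e.injective.ne_iff]
      by_cases huv : u = v <;> simp [huv]
  exact decidesWithin_of_ends key Iff.rfl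

open Real

/-! ### The divisor bound and the running time -/

theorem mul_add_two_le_exp_half {L : ℝ} (hL : 0 < L) : L * (L + 2) ≤ 8 * exp (L / 2) := by
  have := quadratic_le_exp_of_nonneg (x := L / 2) (by positivity)
  nlinarith

theorem sq_le_two_mul_exp {L : ℝ} (hL : 0 < L) : L ^ 2 ≤ 2 * exp L := by
  have := quadratic_le_exp_of_nonneg (x := L) hL.le
  nlinarith

/-- Write the number of divisors as the product of `a + 1` over the prime powers `p ^ a` of `n`, and
split at `p = exp (L / 2)`, the square root of `log n`. For large `p`, `log (a + 1) ≤ a ≤ a * log p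
* (2 / L)`, in total at most `2 * log n / L`. There are at most `exp (L / 2)` small primes, each
contributing at most `L + 2`, in total at most `8 * log n / L`. -/
theorem log_card_divisors_le {n : ℕ} (hn : n ≠ 0) {L : ℝ} (hL : 0 < L)
    (hx : log n = exp L) : log n.divisors.card ≤ 10 * log n / L := by
  have hx1 : 1 ≤ log n := by rw [hx]; exact one_le_exp hL.le
  have hfac : ∑ p ∈ n.primeFactors, (n.factorization p : ℝ) * log p = log n := by
    conv_rhs => rw [← Nat.prod_factorization_pow_eq_self hn]
    rw [Finsupp.prod, Nat.cast_prod, log_prod]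
    · refine Finset.sum_congr rfl fun p _ => by rw [Nat.cast_pow, log_pow]
    · intro p hp
      have := (Nat.prime_of_mem_primeFactors hp).pos
      positivity
  have hlog2 : 0 < log 2 := log_pos (by norm_num)
  have hlog2' : log 2 ≤ 1 := by have := log_two_lt_d9; linarith
  have hterm : ∀ p ∈ n.primeFactors, log ((n.factorization p : ℝ) + 1) ≤
      (n.factorization p : ℝ) * log p * (2 / L) +
        if (p : ℝ) < exp (L / 2) then L + 2 else 0 := by
    intro p hp
    have hpp := Nat.prime_of_mem_primeFactors hp
    have hp2 : (2 : ℝ) ≤ p := by exact_mod_cast hpp.two_le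
    have hlp : log 2 ≤ log p := log_le_log (by norm_num) hp2
    have ha : 1 ≤ n.factorization p :=
      (hpp.dvd_iff_one_le_factorization hn).1 (Nat.dvd_of_mem_primeFactors hp)
    have hle : (n.factorization p : ℝ) * log p ≤ log n := by
      rw [← hfac]
      exact Finset.single_le_sum (f := fun p => (n.factorization p : ℝ) * log p)
        (fun q hq => mul_nonneg (by positivity) (log_natCast_nonneg q)) hp
    split_ifs with hlt
    -- From `log p ≥ 1 / 2` the exponent is at most `2 * log n`, so `a + 1 ≤ 3 * log n ≤ exp 2 * log
    -- n`.
    · have h1 : (n.factorization p : ℝ) + 1 ≤ exp (L + 2) := by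
        have h2 : (n.factorization p : ℝ) * (1 / 2) ≤ log n := by
          refine le_trans ?_ hle
          gcongr
          have := log_two_gt_d9
          linarith
        have h3 : (3 : ℝ) ≤ exp 2 := by have := add_one_le_exp (2 : ℝ); linarith
        rw [exp_add, ← hx]
        nlinarith
      have h4 : log ((n.factorization p : ℝ) + 1) ≤ L + 2 := by
        rw [← log_exp (L + 2)]
        exact log_le_log (by positivity) h1
      have h5 : 0 ≤ (n.factorization p : ℝ) * log p * (2 / L) := by
        have := log_natCast_nonneg p
        positivity
      linarith
    · have h1 : L / 2 ≤ log p := by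
        rw [← log_exp (L / 2)]
        exact log_le_log (exp_pos _) (not_lt.1 hlt)
      have h2 : log ((n.factorization p : ℝ) + 1) ≤ n.factorization p := by
        have := log_le_sub_one_of_pos (x := (n.factorization p : ℝ) + 1) (by positivity)
        linarith
      have h3 : 1 ≤ log p * (2 / L) := by
        calc (1 : ℝ) = L / 2 * (2 / L) := by field_simp
          _ ≤ log p * (2 / L) := by gcongr
      calc log ((n.factorization p : ℝ) + 1) ≤ n.factorization p * 1 := by linarith
        _ ≤ n.factorization p * (log p * (2 / L)) := by gcongr
        _ = _ := by ring
  have hsmall : ((n.primeFactors.filter fun p : ℕ => (p : ℝ) < exp (L / 2)).card : ℝ) ≤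
      exp (L / 2) := by
    have hsub : (n.primeFactors.filter fun p : ℕ => (p : ℝ) < exp (L / 2)) ⊆
        Finset.Icc 1 ⌊exp (L / 2)⌋₊ := by
      intro p hp
      rw [Finset.mem_filter] at hp
      exact Finset.mem_Icc.2 ⟨(Nat.prime_of_mem_primeFactors hp.1).one_le,
        Nat.le_floor hp.2.le⟩
    calc _ ≤ ((Finset.Icc 1 ⌊exp (L / 2)⌋₊).card : ℝ) := by
          exact_mod_cast Finset.card_le_card hsub
      _ = (⌊exp (L / 2)⌋₊ : ℝ) := by simp
      _ ≤ exp (L / 2) := Nat.floor_le (exp_pos _).le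
  have hsum : log n.divisors.card ≤ log n * (2 / L) + exp (L / 2) * (L + 2) := by
    rw [Nat.card_divisors hn, Nat.cast_prod, log_prod (fun p _ => by positivity)]
    calc ∑ p ∈ n.primeFactors, log ((n.factorization p + 1 : ℕ) : ℝ)
        ≤ ∑ p ∈ n.primeFactors, ((n.factorization p : ℝ) * log p * (2 / L) +
            if (p : ℝ) < exp (L / 2) then L + 2 else 0) := by
          refine Finset.sum_le_sum fun p hp => ?_
          have := hterm p hp
          push_cast
          exact this
      _ = log n * (2 / L) +
          (n.primeFactors.filter fun p : ℕ => (p : ℝ) < exp (L / 2)).card * (L + 2) := by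
          rw [Finset.sum_add_distrib, ← Finset.sum_mul, hfac, ← Finset.sum_filter,
            Finset.sum_const, nsmul_eq_mul]
      _ ≤ _ := by gcongr
  have hsq : exp (L / 2) * (L + 2) ≤ 8 * log n / L := by
    rw [le_div_iff₀ hL, hx]
    have h := mul_add_two_le_exp_half hL
    have h' : exp L = exp (L / 2) * exp (L / 2) := by rw [← exp_add]; ring_nf
    rw [h']
    nlinarith [exp_pos (L / 2)]
  calc _ ≤ log n * (2 / L) + 8 * log n / L := by linarith
    _ = _ := by ring

theorem one_lt_log_of_three_le {n : ℕ} (hn : 3 ≤ n) : 1 < log n := by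
  rw [lt_log_iff_exp_lt (by positivity)]
  have h3 : (3 : ℝ) ≤ n := by exact_mod_cast hn
  have := exp_one_lt_d9
  linarith

theorem isTwoPowPowDivLogLog_runTime : IsTwoPowPowDivLogLog runTime := by
  -- The summands pay for three factors of the exponent: `10` for the number of divisors, `2` for
  -- `log n`, and `8` for the numerical constant.
  refine ⟨10 + 2 + 8, by norm_num, fun n hn => ?_⟩
  have hn0 : (0 : ℝ) < n := by positivity
  have hx1 := one_lt_log_of_three_le hn
  set L := log (log n) with hLdef
  have hL : 0 < L := log_pos hx1
  have hx : log n = exp L := (exp_log (by linarith)).symm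
  have hd : ((n.divisors.card : ℕ) : ℝ) ≤ exp (10 * log n / L) := by
    have hpos : (0 : ℝ) < n.divisors.card := by
      have : 0 < n.divisors.card := Finset.card_pos.2 ⟨1, by simp; omega⟩
      exact_mod_cast this
    rw [← exp_log hpos]
    exact exp_le_exp.2 (log_card_divisors_le (by omega) hL hx)
  have hlog : log n ≤ exp (2 * log n / L) := by
    rw [hx]
    refine exp_le_exp.2 ?_
    rw [le_div_iff₀ hL]
    have := sq_le_two_mul_exp hL
    nlinarith
  have hconst : (1024 : ℝ) ≤ exp (8 * log n / L) := by
    have h8 : (8 : ℝ) ≤ 8 * log n / L := by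
      rw [le_div_iff₀ hL, hx]
      have := add_one_le_exp L
      linarith
    have h2 : (1024 : ℝ) ≤ exp 8 := by
      have := exp_one_gt_d9
      calc (1024 : ℝ) ≤ (2.7182818283) ^ 8 := by norm_num
        _ ≤ exp 1 ^ 8 := by gcongr
        _ = exp 8 := by rw [← exp_nat_mul]; norm_num
    exact h2.trans (exp_le_exp.2 h8)
  have hexp : (n : ℝ) ^ ((10 + 2 + 8) / L) =
      exp (10 * log n / L) * exp (2 * log n / L) * exp (8 * log n / L) := by
    rw [rpow_def_of_pos hn0, ← exp_add, ← exp_add]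
    congr 1
    ring
  have hbase : ((n + 32 : ℕ) : ℝ) ≤ exp (4 * log n) := by
    have : n + 32 ≤ n ^ 4 := by
      have h3 : 3 ^ 3 ≤ n ^ 3 := Nat.pow_le_pow_left hn 3
      nlinarith
    calc ((n + 32 : ℕ) : ℝ) ≤ ((n ^ 4 : ℕ) : ℝ) := by exact_mod_cast this
      _ = exp (4 * log n) := by
        rw [Nat.cast_pow]
        nth_rw 1 [← exp_log hn0]
        rw [← exp_nat_mul]
        norm_num
  -- `104 = 4 * 26`, from `n + 32 ≤ n ^ 4` and the exponent in `runTime`.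
  have hrun : (runTime n : ℝ) ≤ exp (104 * (n.divisors.card * log n)) := by
    rw [runTime, Nat.cast_pow]
    calc ((n + 32 : ℕ) : ℝ) ^ (n.divisors.card * 26)
        ≤ exp (4 * log n) ^ (n.divisors.card * 26) := by gcongr
      _ = exp (104 * (n.divisors.card * log n)) := by
        rw [← exp_nat_mul]; push_cast; ring_nf
  refine hrun.trans ?_
  rw [rpow_def_of_pos two_pos, exp_le_exp, hexp]
  have hlog2 : (104 : ℝ) ≤ log 2 * 1024 := by have := log_two_gt_d9; linarith
  calc 104 * (n.divisors.card * log n)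
      ≤ (log 2 * 1024) * (exp (10 * log n / L) * exp (2 * log n / L)) :=
        mul_le_mul hlog2 (mul_le_mul hd hlog (by linarith) (exp_pos _).le)
          (mul_nonneg (Nat.cast_nonneg _) (by linarith)) (by linarith)
    _ ≤ (log 2 * exp (8 * log n / L)) * (exp (10 * log n / L) * exp (2 * log n / L)) := by
        gcongr
    _ = _ := by ring

theorem IsTwoPowPowDivLogLog.isTwoPowLittleO {T : ℕ → ℕ} (h : IsTwoPowPowDivLogLog T) :
    IsTwoPowLittleO T := by
  obtain ⟨c, hc, h⟩ := h
  -- Below `3` the double logarithm is useless; there the trivial `T n ≤ 2 ^ T n` serves. For large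
  -- `n` the inner exponent is at most `1 / 2`, and `n ^ (1 / 2)` is `o(n)`.
  refine ⟨fun n => if 3 ≤ n then (n : ℝ) ^ (c / log (log n)) else T n, ?_, fun n _ => ?_⟩
  · have hhalf : (fun n : ℕ => (n : ℝ) ^ (1 / 2 : ℝ)) =o[Filter.atTop] fun n : ℕ => (n : ℝ) := by
      have h0 : ∀ᶠ n : ℕ in Filter.atTop, (n : ℝ) = 0 → (n : ℝ) ^ (1 / 2 : ℝ) = 0 := by
        filter_upwards [Filter.eventually_gt_atTop 0] with n hn h
        exact absurd h (by positivity)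
      refine (Asymptotics.isLittleO_iff_tendsto' h0).2 ?_
      refine ((tendsto_rpow_neg_atTop (show (0 : ℝ) < 1 / 2 by norm_num)).comp
        tendsto_natCast_atTop_atTop).congr' ?_
      filter_upwards [Filter.eventually_gt_atTop 0] with n hn
      have hn' : (0 : ℝ) < n := by exact_mod_cast hn
      have h1 := rpow_sub_one hn'.ne' (1 / 2 : ℝ)
      norm_num at h1 ⊢
      exact h1
    refine Asymptotics.IsBigO.trans_isLittleO ?_ hhalf
    refine Asymptotics.IsBigO.of_bound 1 ?_
    have hlim : Filter.Tendsto (fun n : ℕ => log (log n)) Filter.atTop Filter.atTop :=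
      tendsto_log_atTop.comp (tendsto_log_atTop.comp tendsto_natCast_atTop_atTop)
    filter_upwards [hlim.eventually_ge_atTop (2 * c), Filter.eventually_ge_atTop 3] with n hn h3
    have hL : 0 < log (log n) := by linarith
    have h1 : (1 : ℝ) ≤ n := by exact_mod_cast (by omega : 1 ≤ n)
    rw [if_pos h3, norm_of_nonneg (by positivity), norm_of_nonneg (by positivity), one_mul]
    refine rpow_le_rpow_of_exponent_le h1 ?_
    rw [div_le_iff₀ hL]
    linarith
  · simp only
    split_ifs with h3
    · exact h n h3
    · rw [rpow_natCast]
      exact_mod_cast Nat.lt_two_pow_self.le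

end CyclicMotif

theorem corollary1 :
    (∀ n : ℕ, 0 < n →
      CyclicMotif.NeighbourhoodDiversityLE (CyclicMotif.powerGraph (CyclicMotif.Zn n))
        n.divisors.card) ∧
    (∃ (p : CyclicMotif.Prog) (T : ℕ → ℕ), CyclicMotif.SolvesFromGraph p T ∧
      CyclicMotif.IsTwoPowLittleO T ∧ CyclicMotif.IsTwoPowPowDivLogLog T) ∧
    (∃ (p : CyclicMotif.Prog) (T : ℕ → ℕ), CyclicMotif.SolvesFromGroup p T ∧
      CyclicMotif.IsTwoPowLittleO T ∧ CyclicMotif.IsTwoPowPowDivLogLog T) := by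
  have hT := CyclicMotif.isTwoPowPowDivLogLog_runTime
  refine ⟨fun n hn => ?_, ⟨_, _, CyclicMotif.solvesFromGraph, hT.isTwoPowLittleO, hT⟩,
    ⟨_, _, CyclicMotif.solvesFromGroup, hT.isTwoPowLittleO, hT⟩⟩
  obtain ⟨part, h⟩ := CyclicMotif.hasCliqueTypes_Zn hn
  exact ⟨part, fun u v huv => (h u v huv).1⟩
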